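/- Let $\mathcal M=(\mathbb R,+,I)$ with $I=[0,1]$ a unary predicate, and let $\mathcal M^*=(\mathbb R^*,+,I^*)\succ\mathcal M$ be a monster model of $\mathrm{Th}(\mathcal M)$, i.e. an elementary extension of $\mathcal M$ that is $\kappa$-saturated and strongly $\kappa$-homogeneous for some strong limit cardinal $\kappa>\aleph_0$. Let $G^*=(\mathbb R^*,+)$, regard $\mathbb Q\subseteq\mathbb R$ as subgroups of $G^*$, and let $\mu=\bigcap_{n\ge 1}[-1/n,1/n]^*$ be the subgroup of infinitesimals, where $X^*$ denotes the interpretation in $\mathcal M^*$ of a set $X\subseteq\mathbb R$ that is $\emptyset$-definable in $\mathcal M$. Then: 1. A subgroup of $G^*$ is invariant under all automorphisms of $\mathcal M^*$ if and only if it is $\{0\}$, or a subgroup of $\mathbb Q$, or of the form $\mu+R$ for some subgroup $R$ of $\mathbb R$, or $G^*$. 2. A subgroup of $G^*$ is type-definable over $\emptyset$ (i.e. is the set of realizations in $\mathcal M^*$ of a set of formulas without parameters) if and only if it is $\{0\}$, $\mu$ or $G^*$. 3. A subgroup of $G^*$ is definable in $\mathcal M^*$ with parameters if and only if it is $\{0\}$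 or $G^*$. -/

import Mathlib

open FirstOrder FirstOrder.Language

universe u

namespace UnitIntervalGroup

/-- The function symbols of the language `{+, I}`: a binary symbol `+`. -/
inductive Func : ℕ → Type
  | add : Func 2

/-- The relation symbols of the language `{+, I}`: a unary predicate `I`. -/
inductive Rel : ℕ → Type
  | I : Rel 1

/-- The language `{+, I}`. -/
abbrev Lang : FirstOrder.Language.{0, 0} := ⟨Func, Rel⟩

/-- The structure `(ℝ, +, I)` with `I = [0, 1]`. -/
instance realStructure : Lang.Structure ℝ where
  funMap := fun f => match f with
    | Func.add => fun v => v 0 + v 1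
  RelMap := fun r => match r with
    | Rel.I => fun v => v 0 ∈ Set.Icc (0 : ℝ) 1

/-! ### Monster models -/

/-- `κ`-saturation: every set of formulas in one variable, over a parameter set of size `< κ`,
that is finitely satisfiable in `M` is realized in `M`. -/
def IsSaturated (L : FirstOrder.Language.{0, 0}) (M : Type u) [L.Structure M] (κ : Cardinal.{u}) : Prop :=
  ∀ A : Set M, Cardinal.mk A < κ → ∀ p : Set (L[[A]].Formula (Fin 1)),
    (∀ p₀ : Finset (L[[A]].Formula (Fin 1)), (p₀ : Set (L[[A]].Formula (Fin 1))) ⊆ p →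
      ∃ x : M, ∀ φ ∈ p₀, φ.Realize (fun _ => x)) →
    ∃ x : M, ∀ φ ∈ p, φ.Realize (fun _ => x)

/-- Strong `κ`-homogeneity: every partial elementary map of `M` with domain of size `< κ` extends
to an automorphism of `M`. -/
def IsStronglyHomogeneous (L : FirstOrder.Language.{0, 0}) (M : Type u) [L.Structure M]
    (κ : Cardinal.{u}) : Prop :=
  ∀ A : Set M, Cardinal.mk A < κ → ∀ f : A → M,
    (∀ φ : L.Formula A, φ.Realize (fun a => (a : M)) ↔ φ.Realize f) →
    ∃ σ : M ≃[L] M, ∀ a : A, σ (a : M) = f a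

/-- `M` is a monster model: it is `κ`-saturated and strongly `κ`-homogeneous for some strong limit
cardinal `κ` greater than the cardinality `max ℵ₀ |L|` of its theory. -/
def IsMonster (L : FirstOrder.Language.{0, 0}) (M : Type u) [L.Structure M] : Prop :=
  ∃ κ : Cardinal.{u}, κ.IsStrongLimit ∧ Cardinal.lift.{u} (max Cardinal.aleph0 L.card) < κ ∧
    IsSaturated L M κ ∧ IsStronglyHomogeneous L M κ

/-! ### Elementary extensions of `(ℝ, +, [0, 1])` -/

/-- An elementary extension `(ℝ*, +, I*)` of `(ℝ, +, [0, 1])`. -/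
structure ElementaryExtension where
  carrier : Type u
  [str : Lang.Structure carrier]
  emb : ℝ ↪ₑ[Lang] carrier

namespace ElementaryExtension

instance : CoeSort ElementaryExtension.{u} (Type u) := ⟨carrier⟩

instance (S : ElementaryExtension.{u}) : Lang.Structure S := S.str

end ElementaryExtension

/-- The term `s + t`. -/
def addTerm {α : Type*} (s t : Lang.Term α) : Lang.Term α :=
  Term.func Func.add ![s, t]

section Group

variable (S : ElementaryExtension.{u})

instance : Add S := ⟨fun x y => Structure.funMap (L := Lang) Func.add ![x, y]⟩

noncomputable instance : Zero S := ⟨S.emb 0⟩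

@[simp]
theorem realize_addTerm {α : Type*} (s t : Lang.Term α) (v : α → S) :
    (addTerm s t).realize v = s.realize v + t.realize v := by
  change Structure.funMap _ _ = Structure.funMap _ _
  congr 1
  funext i
  fin_cases i <;> rfl

@[simp]
theorem realize_addTerm_real {α : Type*} (s t : Lang.Term α) (v : α → ℝ) :
    (addTerm s t).realize v = s.realize v + t.realize v := rfl

theorem emb_zero : S.emb 0 = 0 := rfl

theorem emb_add (r s : ℝ) : S.emb (r + s) = S.emb r + S.emb s := by
  have h := S.emb.map_fun (Func.add : Lang.Functions 2) ![r, s]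
  have h2 : (S.emb ∘ ![r, s]) = ![S.emb r, S.emb s] := by
    funext i
    fin_cases i <;> rfl
  rw [h2] at h
  exact h

theorem add_assoc' (x y z : S) : x + y + z = x + (y + z) := by
  have h := S.emb.map_formula (α := Empty)
    (∀' ∀' ∀' ((addTerm (addTerm (&0) (&1)) (&2)) =' (addTerm (&0) (addTerm (&1) (&2)))))
    Empty.elim
  simp only [Formula.Realize, BoundedFormula.realize_all, BoundedFormula.realize_bdEqual,
    realize_addTerm, realize_addTerm_real] at h
  exact (h.2 fun a b c => add_assoc _ _ _) x y z

theorem add_comm' (x y : S) : x + y = y + x := by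
  have h := S.emb.map_formula (α := Empty)
    (∀' ∀' ((addTerm (&0) (&1)) =' (addTerm (&1) (&0))))
    Empty.elim
  simp only [Formula.Realize, BoundedFormula.realize_all, BoundedFormula.realize_bdEqual,
    realize_addTerm, realize_addTerm_real] at h
  exact (h.2 fun a b => add_comm _ _) x y

theorem zero_add' (x : S) : 0 + x = x := by
  have h := S.emb.map_formula (α := Fin 1)
    (∀' ((addTerm (Term.var (Sum.inl 0)) (&0)) =' (&0))) (fun _ => 0)
  simp only [Formula.Realize, BoundedFormula.realize_all, BoundedFormula.realize_bdEqual,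
    realize_addTerm, realize_addTerm_real, Term.realize_var, Sum.elim_inl] at h
  exact (h.2 fun a => zero_add _) x

theorem exists_neg (x : S) : ∃ y : S, y + x = 0 := by
  have h := S.emb.map_formula (α := Fin 1)
    (∀' ∃' ((addTerm (&1) (&0)) =' (Term.var (Sum.inl 0)))) (fun _ => 0)
  simp only [Formula.Realize, BoundedFormula.realize_all, BoundedFormula.realize_ex,
    BoundedFormula.realize_bdEqual,
    realize_addTerm, realize_addTerm_real, Term.realize_var, Sum.elim_inl] at h
  exact (h.2 fun a => ⟨-a, neg_add_cancel a⟩) x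

noncomputable instance : Neg S := ⟨fun x => (exists_neg S x).choose⟩

/-- The group `G* = (ℝ*, +)`. -/
noncomputable instance : AddCommGroup S where
  add_assoc := add_assoc' S
  zero_add := zero_add' S
  add_zero x := by rw [add_comm']; exact zero_add' S x
  neg_add_cancel x := (exists_neg S x).choose_spec
  add_comm := add_comm' S
  nsmul := nsmulRec
  zsmul := zsmulRec

/-- The inclusion of `(ℝ, +)` in `G*`. -/
noncomputable def incl : ℝ →+ S where
  toFun := S.emb
  map_zero' := emb_zero S
  map_add' := emb_add S

/-- The copy of `(ℚ, +)` in `G*`. -/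
noncomputable def rationals : AddSubgroup S :=
  ((incl S).comp (Rat.castHom ℝ).toAddMonoidHom).range

end Group

/-! ### Infinitesimals -/

/-- The formula `φ` defines the set `X ⊆ ℝ` in `(ℝ, +, [0, 1])` without parameters. -/
def Defines (φ : Lang.Formula (Fin 1)) (X : Set ℝ) : Prop :=
  ∀ r : ℝ, φ.Realize (fun _ => r) ↔ r ∈ X

/-- The interpretation `X*` in the extension of a set `X ⊆ ℝ` that is definable without parameters;
by elementarity it does not depend on the defining formula. -/
def star (S : ElementaryExtension.{u}) (X : Set ℝ) : Set S :=
  {x | ∃ φ : Lang.Formula (Fin 1), Defines φ X ∧ φ.Realize (fun _ => x)}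

/-- A formula that holds of all tuples of reals holds of all tuples of the extension. -/
theorem transfer (S : ElementaryExtension.{u}) {n : ℕ} (θ : Lang.Formula (Fin n))
    (h : ∀ v : Fin n → ℝ, θ.Realize v) (v : Fin n → S) : θ.Realize v := by
  have key := S.emb.map_formula (Formula.iAlls (Fin n)
    (Formula.relabel (Sum.inr : Fin n → Empty ⊕ Fin n) θ)) Empty.elim
  simp only [Formula.realize_iAlls, Formula.realize_relabel] at key
  exact key.2 (fun w => h w) v

theorem mem_star_iff (S : ElementaryExtension.{u}) {X : Set ℝ} {φ : Lang.Formula (Fin 1)}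
    (hφ : Defines φ X) (x : S) : x ∈ star S X ↔ φ.Realize (fun _ => x) := by
  refine ⟨?_, fun h => ⟨φ, hφ, h⟩⟩
  rintro ⟨ψ, hψ, hx⟩
  have key := transfer S (ψ.imp φ) ?_ (fun _ => x)
  · exact (Formula.realize_imp.1 key) hx
  · intro v
    have hv0 : v = fun _ => v 0 := by
      funext i
      rw [Subsingleton.elim i 0]
    rw [hv0]
    exact Formula.realize_imp.2 fun hv => (hφ _).2 ((hψ _).1 hv)

theorem emb_mem_star_iff (S : ElementaryExtension.{u}) {X : Set ℝ} {φ : Lang.Formula (Fin 1)}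
    (hφ : Defines φ X) (r : ℝ) : S.emb r ∈ star S X ↔ r ∈ X := by
  rw [mem_star_iff S hφ, ← hφ r]
  exact S.emb.map_formula φ (fun _ => r)

/-- The term `(k + 1) t`. -/
def multTerm {α : Type} (t : Lang.Term α) : ℕ → Lang.Term α
  | 0 => t
  | k + 1 => addTerm (multTerm t k) t

theorem realize_multTerm_real {α : Type} (t : Lang.Term α) (v : α → ℝ) (k : ℕ) :
    (multTerm t k).realize v = ((k : ℝ) + 1) * t.realize v := by
  induction k with
  | zero => simp [multTerm]
  | succ k ih =>
    rw [multTerm, realize_addTerm_real, ih]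
    push_cast
    ring

/-- The formula saying that `(k + 1) x` or `-(k + 1) x` lies in `I`. -/
def intervalFormula (k : ℕ) : Lang.Formula (Fin 1) :=
  ∃' ((Relations.boundedFormula₁ (Rel.I : Lang.Relations 1)
        (multTerm (Term.var (Sum.inl 0)) k)) ⊔
      (((addTerm (addTerm (Term.var (Sum.inl 0)) (&0)) (addTerm (Term.var (Sum.inl 0)) (&0))) ='
        (addTerm (Term.var (Sum.inl 0)) (&0))) ⊓
      (Relations.boundedFormula₁ (Rel.I : Lang.Relations 1) (multTerm (&0) k))))

theorem relMap_I_real (r : ℝ) :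
    Structure.RelMap (L := Lang) (M := ℝ) (n := 1) Rel.I ![r] ↔ 0 ≤ r ∧ r ≤ 1 := Iff.rfl

theorem defines_intervalFormula (n : ℕ) (hn : 0 < n) :
    Defines (intervalFormula (n - 1)) (Set.Icc (-(1 / (n : ℝ))) (1 / (n : ℝ))) := by
  obtain ⟨k, rfl⟩ : ∃ k, n = k + 1 := ⟨n - 1, by omega⟩
  intro r
  have hk : (0 : ℝ) < (k : ℝ) + 1 := by positivity
  simp only [intervalFormula, Formula.Realize, BoundedFormula.realize_ex,
    BoundedFormula.realize_sup, BoundedFormula.realize_inf, BoundedFormula.realize_bdEqual,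
    BoundedFormula.realize_rel₁, realize_addTerm_real, realize_multTerm_real, relMap_I_real,
    Term.realize_var, Sum.elim_inl, Set.mem_Icc, Nat.add_sub_cancel,
    Nat.cast_add, Nat.cast_one]
  have e1 : (-(1 / ((k : ℝ) + 1)) ≤ r) ↔ -1 ≤ ((k : ℝ) + 1) * r := by
    rw [← neg_div, div_le_iff₀ hk, mul_comm]
  have e2 : (r ≤ 1 / ((k : ℝ) + 1)) ↔ ((k : ℝ) + 1) * r ≤ 1 := by
    rw [le_div_iff₀ hk, mul_comm]
  rw [e1, e2]
  constructor
  · rintro ⟨a, h | ⟨h, h2⟩⟩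
    · exact ⟨by linarith, h.2⟩
    · change r + a + (r + a) = r + a at h
      change 0 ≤ ((k : ℝ) + 1) * a ∧ ((k : ℝ) + 1) * a ≤ 1 at h2
      obtain rfl : a = -r := by linarith
      constructor <;> nlinarith
  · rintro ⟨h1, h2⟩
    refine ⟨-r, ?_⟩
    rcases le_total 0 (((k : ℝ) + 1) * r) with h | h
    · exact Or.inl ⟨h, h2⟩
    · refine Or.inr ⟨?_, ?_⟩
      · change r + -r + (r + -r) = r + -r
        ring
      · change 0 ≤ ((k : ℝ) + 1) * -r ∧ ((k : ℝ) + 1) * -r ≤ 1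
        constructor <;> linarith

theorem star_add (S : ElementaryExtension.{u}) {X Y Z : Set ℝ} {φ ψ χ : Lang.Formula (Fin 1)}
    (hφ : Defines φ X) (hψ : Defines ψ Y) (hχ : Defines χ Z)
    (h : ∀ a ∈ X, ∀ b ∈ Y, a + b ∈ Z) {x y : S} (hx : x ∈ star S X) (hy : y ∈ star S Y) :
    x + y ∈ star S Z := by
  rw [mem_star_iff S hφ] at hx
  rw [mem_star_iff S hψ] at hy
  rw [mem_star_iff S hχ]
  have key := transfer S (n := 2)
    ((BoundedFormula.subst φ fun _ => Term.var (0 : Fin 2)).imp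
      ((BoundedFormula.subst ψ fun _ => Term.var (1 : Fin 2)).imp
        (BoundedFormula.subst χ fun _ => addTerm (Term.var (0 : Fin 2)) (Term.var 1)))) ?_ ![x, y]
  · simp only [Formula.Realize, BoundedFormula.realize_imp, BoundedFormula.realize_subst,
      realize_addTerm, Term.realize_var] at key
    exact key hx hy
  · intro v
    simp only [Formula.Realize, BoundedFormula.realize_imp, BoundedFormula.realize_subst,
      realize_addTerm_real, Term.realize_var]
    exact fun h0 h1 => (hχ _).2 (h _ ((hφ _).1 h0) _ ((hψ _).1 h1))

theorem star_neg (S : ElementaryExtension.{u}) {X : Set ℝ} {φ : Lang.Formula (Fin 1)}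
    (hφ : Defines φ X) (h : ∀ a ∈ X, -a ∈ X) {x : S} (hx : x ∈ star S X) : -x ∈ star S X := by
  rw [mem_star_iff S hφ] at hx ⊢
  let s : Lang.Term (Fin 2) := addTerm (Term.var (0 : Fin 2)) (Term.var 1)
  have key := transfer S (n := 2)
    ((BoundedFormula.subst φ fun _ => Term.var (0 : Fin 2)).imp
      ((Term.equal (addTerm s s) s).imp
        (BoundedFormula.subst φ fun _ => Term.var (1 : Fin 2)))) ?_ ![x, -x]
  · have key' := Formula.realize_imp.1 (Formula.realize_imp.1 key ?_) ?_
    · exact BoundedFormula.realize_subst.1 key'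
    · exact BoundedFormula.realize_subst.2 hx
    · rw [Formula.realize_equal]
      simp [s]
  · intro v
    refine Formula.realize_imp.2 fun h0 => Formula.realize_imp.2 fun h1 => ?_
    rw [Formula.realize_equal] at h1
    simp only [s, realize_addTerm_real, Term.realize_var] at h1
    simp only [Formula.Realize, BoundedFormula.realize_subst, Term.realize_var] at h0 ⊢
    have h2 : v 1 = -(v 0) := by linarith
    rw [h2]
    exact (hφ _).2 (h _ ((hφ _).1 h0))

/-- The subgroup `μ = ⋂ₙ [-1/n, 1/n]*` of infinitesimals, `n` ranging over positive integers. -/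
noncomputable def infinitesimals (S : ElementaryExtension.{u}) : AddSubgroup S where
  carrier := ⋂ (n : ℕ) (_ : 0 < n), star S (Set.Icc (-(1 / (n : ℝ))) (1 / (n : ℝ)))
  zero_mem' := by
    simp only [Set.mem_iInter]
    intro n hn
    rw [← emb_zero, emb_mem_star_iff S (defines_intervalFormula n hn)]
    constructor
    · simp
    · positivity
  add_mem' := by
    intro x y hx hy
    simp only [Set.mem_iInter] at hx hy ⊢
    intro n hn
    have h2 := defines_intervalFormula (2 * n) (by omega)
    refine star_add S h2 h2 (defines_intervalFormula n hn) ?_ (hx (2 * n) (by omega))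
      (hy (2 * n) (by omega))
    rintro a ⟨ha, ha'⟩ b ⟨hb, hb'⟩
    have e : 1 / (n : ℝ) = 1 / ((2 * n : ℕ) : ℝ) + 1 / ((2 * n : ℕ) : ℝ) := by
      push_cast
      field_simp
      norm_num
    rw [e]
    constructor <;> linarith
  neg_mem' := by
    intro x hx
    simp only [Set.mem_iInter] at hx ⊢
    intro n hn
    refine star_neg S (defines_intervalFormula n hn) ?_ (hx n hn)
    rintro a ⟨ha, ha'⟩
    constructor <;> linarith

/-! ### Kinds of subgroups -/

/-- `X` is invariant under all automorphisms of `M`. -/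
def IsInvariant (L : FirstOrder.Language.{0, 0}) {M : Type u} [L.Structure M] (X : Set M) : Prop :=
  ∀ σ : M ≃[L] M, σ '' X = X

/-- `X` is type-definable over `∅`: it is defined by a set of formulas without parameters. -/
def IsTypeDefinable (L : FirstOrder.Language.{0, 0}) {M : Type u} [L.Structure M]
    (X : Set M) : Prop :=
  ∃ p : Set (L.Formula (Fin 1)), X = {x | ∀ φ ∈ p, φ.Realize (fun _ => x)}

end UnitIntervalGroup

namespace UnitIntervalGroup

/-! The order of `ℝ` is visible in the language only on bounded intervals, but an order can be put
back on `G*`. The multiples of elements of `I*` form a positive cone whose group of differences, the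
finite elements, is thereby ordered. The quotient by the finite elements is torsion-free, so it
carries some linear order, and the two combine lexicographically. Then `G*` is a divisible ordered
abelian group in which `I*` is the interval `[0, e]`, with `e` the image of `1`
(`exists_isIntervalGroup`). The order involves a choice and automorphisms need not preserve it; it
serves only to eliminate quantifiers. By back-and-forth, the truth of a formula depends only on the
signs of finitely many integer affine forms in its variables and `e` (`exists_agree_realize_iff`).

With strong homogeneity, two elements lying in the same cut over the rational multiples of `e` are
conjugate (`exists_aut_apply_eq`). Hence an invariant subgroup with an infinite element contains all
positive infinite elements, and so everything. An invariant subgroup with an element off `ℚ`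
contains `μ`, since that element can be moved by any infinitesimal in one of the two directions; if
all its elements are finite, standard parts give `μ + R`. Otherwise it lies in `ℚ`. Conversely,
automorphisms fix `ℚ` and move each real by an infinitesimal.

If a type-definable subgroup is not inside `μ`, the multiples of some element are unbounded among
the finite elements; saturation yields an infinite element, and the subgroup is `G*`. A definable
set is a union of cells cut out by finitely many thresholds; a subgroup of this kind is convex by
the pigeonhole principle, and divisibility forbids a proper nonzero one. -/

/-- `V` is a divisible ordered abelian group, read as a structure for `{+, I}` with `I = [0, e]`. -/
structure IsIntervalGroup (V : Type*) [AddCommGroup V] [LinearOrder V] [Lang.Structure V]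
    (e : V) : Prop where
  funMap_add : ∀ v : Fin 2 → V, Structure.funMap (L := Lang) Func.add v = v 0 + v 1
  relMap_I : ∀ v : Fin 1 → V, Structure.RelMap (L := Lang) Rel.I v ↔ 0 ≤ v 0 ∧ v 0 ≤ e
  unit_pos : 0 < e
  exists_zsmul_eq : ∀ (k : ℤ) (x : V), 0 < k → ∃ y, k • y = x

/-! ### Integer affine forms -/

section Affine

variable {V : Type*} [AddCommGroup V] {ι : Type*} [Fintype ι]

/-- The value at `v` of the affine form with coefficients `c` and constant term `d • e`. -/
def affine (e : V) (v : ι → V) (c : ι → ℤ) (d : ℤ) : V :=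
  ∑ i, c i • v i + d • e

theorem affine_neg (e : V) (v : ι → V) (c : ι → ℤ) (d : ℤ) :
    affine e v (-c) (-d) = -affine e v c d := by
  simp [affine, add_comm]

theorem affine_sub (e : V) (v : ι → V) (c c' : ι → ℤ) (d d' : ℤ) :
    affine e v (c - c') (d - d') = affine e v c d - affine e v c' d' := by
  simp only [affine, Pi.sub_apply, sub_smul, Finset.sum_sub_distrib]
  abel

theorem affine_add (e : V) (v : ι → V) (c c' : ι → ℤ) (d d' : ℤ) :
    affine e v (c + c') (d + d') = affine e v c d + affine e v c' d' := by
  simp only [affine, Pi.add_apply, add_smul, Finset.sum_add_distrib]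
  abel

theorem affine_smul (e : V) (v : ι → V) (k : ℤ) (c : ι → ℤ) (d : ℤ) :
    affine e v (k • c) (k * d) = k • affine e v c d := by
  simp only [affine, Pi.smul_apply, smul_add, Finset.smul_sum, smul_eq_mul, mul_smul]

theorem affine_elim_snoc (e : V) {α : Type*} [Fintype α] {n : ℕ} (v : α → V) (xs : Fin n → V)
    (x : V) (c : α ⊕ Fin (n + 1) → ℤ) (d : ℤ) :
    affine e (Sum.elim v (Fin.snoc xs x : Fin (n + 1) → V)) c d =
      affine e (Sum.elim v xs) (c ∘ Sum.map id Fin.castSucc) d + c (Sum.inr (Fin.last n)) • x := by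
  simp only [affine, Fintype.sum_sum_type, Sum.elim_inl, Sum.elim_inr, Fin.sum_univ_castSucc,
    Fin.snoc_castSucc, Fin.snoc_last, Function.comp, Sum.map_inl, Sum.map_inr, id]
  abel

end Affine

/-- The back-and-forth step for dense orders without endpoints: `y` copies the position of `x` among
finitely many points. -/
theorem exists_same_cut {V : Type*} [LinearOrder V] [Nonempty V] [DenselyOrdered V]
    [NoMinOrder V] [NoMaxOrder V] {τ : Type*} {s : Set τ} (hs : s.Finite) {a b : τ → V}
    (hab : ∀ i ∈ s, ∀ j ∈ s, (a i < a j ↔ b i < b j)) (x : V) :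
    ∃ y, ∀ i ∈ s, (a i < x ↔ b i < y) ∧ (x < a i ↔ y < b i) := by
  classical
  by_cases hx : ∃ i ∈ s, a i = x
  · obtain ⟨i, hi, rfl⟩ := hx
    exact ⟨b i, fun j hj => ⟨hab j hj i hi, hab i hi j hj⟩⟩
  · push Not at hx
    obtain ⟨y, h1, h2⟩ := Order.exists_between_finsets
      ((hs.toFinset.filter fun i => a i < x).image b)
      ((hs.toFinset.filter fun i => x < a i).image b) (by
        simp only [Finset.mem_image, Finset.mem_filter, Set.Finite.mem_toFinset]
        rintro _ ⟨i, ⟨hi, hi'⟩, rfl⟩ _ ⟨j, ⟨hj, hj'⟩, rfl⟩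
        exact (hab i hi j hj).1 (hi'.trans hj'))
    simp only [Finset.mem_image, Finset.mem_filter, Set.Finite.mem_toFinset, forall_exists_index,
      and_imp] at h1 h2
    refine ⟨y, fun i hi => ?_⟩
    rcases lt_or_gt_of_ne (hx i hi) with h | h
    · have := h1 _ i hi h rfl
      exact ⟨iff_of_true h this, iff_of_false h.not_gt this.not_gt⟩
    · have := h2 _ i hi h rfl
      exact ⟨iff_of_false h.not_gt this.not_gt, iff_of_true h this⟩

/-! ### Quantifier elimination by back-and-forth on signs of affine forms -/

section Agreement

variable {V : Type*} [AddCommGroup V] [LinearOrder V] {ι : Type*} [Fintype ι]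

/-- The affine forms with coefficients at most `N` have the same signs at `v` and at `w`. -/
def Agree (e : V) (N : ℤ) (v w : ι → V) : Prop :=
  ∀ (c : ι → ℤ) (d : ℤ), (∀ i, |c i| ≤ N) → |d| ≤ N →
    (0 < affine e v c d ↔ 0 < affine e w c d)

theorem Agree.mono {e : V} {N N' : ℤ} (h : N ≤ N') {v w : ι → V} (hA : Agree e N' v w) :
    Agree e N v w :=
  fun c d hc hd => hA c d (fun i => (hc i).trans h) (hd.trans h)

theorem Agree.symm {e : V} {N : ℤ} {v w : ι → V} (hA : Agree e N v w) : Agree e N w v :=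
  fun c d hc hd => (hA c d hc hd).symm

theorem Agree.nonpos_iff {N : ℤ} {v w : ι → V} (hA : Agree e N v w) {c : ι → ℤ} {d : ℤ}
    (hc : ∀ i, |c i| ≤ N) (hd : |d| ≤ N) : affine e v c d ≤ 0 ↔ affine e w c d ≤ 0 := by
  simpa using (hA c d hc hd).not

variable [Lang.Structure V] {e : V}

/-- A solution `t` of `k t + affine e v c d = 0`, for positive `k`. -/
noncomputable def threshold (hV : IsIntervalGroup V e) (v : ι → V) (c : ι → ℤ) (d k : ℤ) : V :=
  open Classical in
  if h : 0 < k then (hV.exists_zsmul_eq k (-affine e v c d) h).choose else 0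

theorem zsmul_threshold (hV : IsIntervalGroup V e) (v : ι → V) (c : ι → ℤ) (d : ℤ) {k : ℤ}
    (hk : 0 < k) : k • threshold hV v c d k = -affine e v c d := by
  rw [threshold, dif_pos hk]
  exact (hV.exists_zsmul_eq k (-affine e v c d) hk).choose_spec

theorem exists_realize_term_eq_affine (hV : IsIntervalGroup V e) (t : Lang.Term ι) :
    ∃ c : ι → ℤ, ∀ v : ι → V, t.realize v = affine e v c 0 := by
  classical
  induction t with
  | var i => exact ⟨Pi.single i 1, fun v => by simp [affine, Pi.single_apply, ite_smul]⟩
  | func f ts ih =>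
    cases f
    choose c hc using ih
    refine ⟨c 0 + c 1, fun v => ?_⟩
    rw [Term.realize_func, hV.funMap_add, hc, hc, ← affine_add, add_zero]

variable [IsOrderedAddMonoid V]

theorem threshold_lt_iff (hV : IsIntervalGroup V e) (v : ι → V) (c : ι → ℤ) (d : ℤ) {k : ℤ}
    (hk : 0 < k) (x : V) : threshold hV v c d k < x ↔ 0 < affine e v c d + k • x := by
  rw [← zsmul_lt_zsmul_iff_right hk, zsmul_threshold hV v c d hk, neg_lt_iff_pos_add']

theorem lt_threshold_iff (hV : IsIntervalGroup V e) (v : ι → V) (c : ι → ℤ) (d : ℤ) {k : ℤ}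
    (hk : 0 < k) (x : V) :
    x < threshold hV v c d k ↔ 0 < affine e v (-c) (-d) + (-k) • x := by
  rw [← zsmul_lt_zsmul_iff_right hk, zsmul_threshold hV v c d hk, affine_neg, neg_smul,
    ← neg_add, neg_pos, lt_neg_iff_add_neg, add_comm]

theorem threshold_lt_threshold_iff (hV : IsIntervalGroup V e) (v : ι → V) (c c' : ι → ℤ)
    (d d' : ℤ) {k k' : ℤ} (hk : 0 < k) (hk' : 0 < k') :
    threshold hV v c d k < threshold hV v c' d' k' ↔
      0 < affine e v (k' • c - k • c') (k' * d - k * d') := by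
  rw [← zsmul_lt_zsmul_iff_right (mul_pos hk hk'), mul_smul, mul_smul, smul_comm k k',
    zsmul_threshold hV v c d hk, zsmul_threshold hV v c' d' hk', affine_sub, affine_smul,
    affine_smul, smul_neg, smul_neg, neg_lt_neg_iff, sub_pos]

/-- Indices of the thresholds coming from affine forms with coefficients at most `N`. -/
def thresholdIndex (ι : Type*) (N : ℤ) : Set ((ι → ℤ) × ℤ × ℤ) :=
  {s | (∀ i, |s.1 i| ≤ N) ∧ |s.2.1| ≤ N ∧ 0 < s.2.2 ∧ s.2.2 ≤ N}

theorem finite_thresholdIndex (ι : Type*) [Finite ι] (N : ℤ) : (thresholdIndex ι N).Finite := by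
  have h1 : {c : ι → ℤ | ∀ i, c i ∈ Set.Icc (-N) N}.Finite :=
    Set.Finite.pi' fun _ => Set.finite_Icc _ _
  refine (h1.prod ((Set.finite_Icc (-N) N).prod (Set.finite_Icc 0 N))).subset ?_
  rintro ⟨c, d, k⟩ ⟨h, h', h'', h'''⟩
  exact ⟨fun i => abs_le.1 (h i), abs_le.1 h', h''.le, h'''⟩

/-- If the new variable has coefficient `k ≠ 0`, the sign of the form says on which side of one
threshold the variable lies; negating all coefficients makes `k` positive. If `k = 0` the form does
not see the new variable and `hA` applies. -/
theorem agree_elim_snoc (hV : IsIntervalGroup V e) {α : Type*} [Fintype α] {n : ℕ} {N : ℤ}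
    {v w : α → V} {xs ys : Fin n → V} (hA : Agree e N (Sum.elim v xs) (Sum.elim w ys)) {x y : V}
    (hx : ∀ s ∈ thresholdIndex (α ⊕ Fin n) N,
      (threshold hV (Sum.elim v xs) s.1 s.2.1 s.2.2 < x ↔
        threshold hV (Sum.elim w ys) s.1 s.2.1 s.2.2 < y) ∧
      (x < threshold hV (Sum.elim v xs) s.1 s.2.1 s.2.2 ↔
        y < threshold hV (Sum.elim w ys) s.1 s.2.1 s.2.2)) :
    Agree e N (Sum.elim v (Fin.snoc xs x : Fin (n + 1) → V))
      (Sum.elim w (Fin.snoc ys y : Fin (n + 1) → V)) := by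
  intro c d hc hd
  rw [affine_elim_snoc, affine_elim_snoc]
  have hc' : ∀ i, |(c ∘ Sum.map id Fin.castSucc : α ⊕ Fin n → ℤ) i| ≤ N := fun i => hc _
  have hk := hc (Sum.inr (Fin.last n))
  generalize c (Sum.inr (Fin.last n)) = k at hk
  generalize (c ∘ Sum.map id Fin.castSucc : α ⊕ Fin n → ℤ) = c' at hc'
  rcases lt_trichotomy k 0 with h | rfl | h
  · have h0 : 0 < -k := by omega
    have := (hx (-c', -d, -k) ⟨by simpa using hc', by simpa using hd, h0,
      (neg_le_abs k).trans hk⟩).2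
    simpa only [lt_threshold_iff hV _ _ _ h0, neg_neg] using this
  · simpa using hA c' d hc' hd
  · have := (hx (c', d, k) ⟨hc', hd, h, (le_abs_self k).trans hk⟩).1
    simpa only [threshold_lt_iff hV _ _ _ h] using this

theorem IsIntervalGroup.densely (hV : IsIntervalGroup V e) : DenselyOrdered V where
  dense a b hab := by
    obtain ⟨y, hy⟩ := hV.exists_zsmul_eq 2 (a + b) two_pos
    rw [two_zsmul] at hy
    refine ⟨y, ?_, ?_⟩
    · by_contra! h
      exact (add_lt_add_of_le_of_lt h (h.trans_lt hab)).ne hy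
    · by_contra! h
      exact (add_lt_add_of_lt_of_le (hab.trans_le h) h).ne hy.symm

/-- Comparing two thresholds with denominators `k, k' ≤ N` means taking the sign of a form with
coefficients `k' c - k c'`, hence the bound `2 N²`. Agreement up to that bound orders the thresholds
of both tuples alike, so a matching cut for `y` exists. -/
theorem Agree.exists_extend (hV : IsIntervalGroup V e) {α : Type*} [Fintype α] {n : ℕ} {N : ℤ}
    (hN : 1 ≤ N) {v w : α → V} {xs ys : Fin n → V}
    (hA : Agree e (2 * N * N) (Sum.elim v xs) (Sum.elim w ys)) (x : V) :
    ∃ y, Agree e N (Sum.elim v (Fin.snoc xs x : Fin (n + 1) → V))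
      (Sum.elim w (Fin.snoc ys y : Fin (n + 1) → V)) := by
  have := hV.densely
  have : Nontrivial V := ⟨0, e, hV.unit_pos.ne⟩
  have bound : ∀ k k' c c' : ℤ, 0 < k → k ≤ N → 0 < k' → k' ≤ N → |c| ≤ N → |c'| ≤ N →
      |k' * c - k * c'| ≤ 2 * N * N := by
    intro k k' c c' hk hkN hk' hkN' hc hc'
    refine (abs_sub _ _).trans ?_
    rw [abs_mul, abs_mul, abs_of_pos hk, abs_of_pos hk']
    have := mul_le_mul hkN hc' (abs_nonneg _) (by omega)
    have := mul_le_mul hkN' hc (abs_nonneg _) (by omega)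
    linarith
  obtain ⟨y, hy⟩ := exists_same_cut (finite_thresholdIndex (α ⊕ Fin n) N)
    (a := fun s => threshold hV (Sum.elim v xs) s.1 s.2.1 s.2.2)
    (b := fun s => threshold hV (Sum.elim w ys) s.1 s.2.1 s.2.2) (by
      rintro ⟨c, d, k⟩ ⟨hc, hd, hk, hkN⟩ ⟨c', d', k'⟩ ⟨hc', hd', hk', hkN'⟩
      dsimp only at *
      rw [threshold_lt_threshold_iff hV _ _ _ _ _ hk hk',
        threshold_lt_threshold_iff hV _ _ _ _ _ hk hk']
      exact hA _ _ (fun i => bound _ _ _ _ hk hkN hk' hkN' (hc i) (hc' i))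
        (bound _ _ _ _ hk hkN hk' hkN' hd hd')) x
  exact ⟨y, agree_elim_snoc hV (hA.mono (by nlinarith)) hy⟩

theorem exists_abs_le (c : ι → ℤ) : ∃ N : ℤ, 1 ≤ N ∧ ∀ i, |c i| ≤ N :=
  ⟨1 + ∑ i, |c i|, by have := Finset.sum_nonneg (s := Finset.univ) fun i _ => abs_nonneg (c i)
                      linarith,
    fun i => by
      have := Finset.single_le_sum (fun i _ => abs_nonneg (c i)) (Finset.mem_univ i)
      linarith⟩

/-- Tuples that agree on sufficiently many affine forms satisfy the same formulas. -/
theorem exists_agree_realize_iff (hV : IsIntervalGroup V e) {α : Type*} [Fintype α] {n : ℕ}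
    (φ : Lang.BoundedFormula α n) :
    ∃ N : ℤ, 1 ≤ N ∧ ∀ (v w : α → V) (xs ys : Fin n → V),
      Agree e N (Sum.elim v xs) (Sum.elim w ys) → (φ.Realize v xs ↔ φ.Realize w ys) := by
  induction φ with
  | falsum => exact ⟨1, le_rfl, fun _ _ _ _ _ => Iff.rfl⟩
  | equal t₁ t₂ =>
    obtain ⟨c, hc⟩ := exists_realize_term_eq_affine hV t₁
    obtain ⟨c', hc'⟩ := exists_realize_term_eq_affine hV t₂
    obtain ⟨N, hN, hN'⟩ := exists_abs_le (c - c')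
    refine ⟨N, hN, fun v w xs ys hA => ?_⟩
    change t₁.realize _ = t₂.realize _ ↔ t₁.realize _ = t₂.realize _
    -- An equation is a pair of opposite weak inequalities. The constant is written `0 - 0` so that
    -- `affine_sub` can rewrite the form.
    have h1 := hA.nonpos_iff hN' (d := 0 - 0) (by simp; omega)
    have h2 := hA.nonpos_iff (c := -(c - c')) (d := -(0 - 0)) 
      (fun i => by rw [Pi.neg_apply, abs_neg]; exact hN' i) (by simp; omega)
    rw [affine_neg, affine_neg] at h2
    rw [affine_sub, affine_sub] at h1 h2
    rw [hc, hc', hc, hc', ← sub_eq_zero, le_antisymm_iff, h1, ← neg_nonpos, h2, neg_nonpos,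
      ← le_antisymm_iff, sub_eq_zero]
  | rel R ts =>
    cases R
    obtain ⟨c, hc⟩ := exists_realize_term_eq_affine hV (ts 0)
    obtain ⟨N, hN, hN'⟩ := exists_abs_le c
    refine ⟨N, hN, fun v w xs ys hA => ?_⟩
    change Structure.RelMap _ _ ↔ Structure.RelMap _ _
    rw [hV.relMap_I, hV.relMap_I, hc, hc]
    have h1 := hA.nonpos_iff (c := -c) (d := -0) (by simpa using hN') (by simp; omega)
    have h2 := hA.nonpos_iff (d := -1) hN' (by simpa using hN)
    rw [affine_neg, affine_neg, neg_nonpos, neg_nonpos] at h1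
    have h3 : ∀ v : _ → V, affine e v c 0 ≤ e ↔ affine e v c (-1) ≤ 0 := fun v => by
      simp [affine]
    rw [h1, h3, h3, h2]
  | imp φ ψ ihφ ihψ =>
    obtain ⟨N, hN, h⟩ := ihφ
    obtain ⟨N', hN', h'⟩ := ihψ
    refine ⟨max N N', hN.trans (le_max_left _ _), fun v w xs ys hA => ?_⟩
    rw [BoundedFormula.realize_imp, BoundedFormula.realize_imp,
      h v w xs ys (hA.mono (le_max_left _ _)), h' v w xs ys (hA.mono (le_max_right _ _))]
  | all φ ih =>
    obtain ⟨N, hN, h⟩ := ih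
    have key : ∀ (v w : α → V) xs ys, Agree e (2 * N * N) (Sum.elim v xs) (Sum.elim w ys) →
        φ.all.Realize v xs → φ.all.Realize w ys := fun v w xs ys hA hv y => by
      obtain ⟨x, hx⟩ := hA.symm.exists_extend hV hN y
      exact (h _ _ _ _ hx).2 (hv x)
    exact ⟨2 * N * N, by nlinarith, fun v w xs ys hA =>
      ⟨key v w xs ys hA, key w v ys xs hA.symm⟩⟩

end Agreement

end UnitIntervalGroup

namespace UnitIntervalGroup

/-! ### First-order facts about `I*` transferred from `ℝ` -/

section Transfer

variable (S : ElementaryExtension.{u})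

/-- Membership in `I*`. -/
def MemI {S : ElementaryExtension.{u}} (x : S) : Prop :=
  Structure.RelMap (L := Lang) (n := 1) Rel.I ![x]

theorem realize_multTerm {α : Type} (t : Lang.Term α) (v : α → S) (k : ℕ) :
    (multTerm t k).realize v = (k + 1) • t.realize v := by
  induction k with
  | zero => simp [multTerm]
  | succ k ih => rw [multTerm, realize_addTerm, ih, succ_nsmul _ (k + 1)]

/-- The formula saying that `t` lies in `I`. -/
abbrev memIFormula {α : Type} {n : ℕ} (t : Lang.Term (α ⊕ Fin n)) : Lang.BoundedFormula α n :=
  Relations.boundedFormula₁ (Rel.I : Lang.Relations 1) t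

theorem memI_emb_iff (r : ℝ) : MemI (S.emb r) ↔ 0 ≤ r ∧ r ≤ 1 := by
  have h := S.emb.map_formula (α := Fin 1) (memIFormula (Term.var (Sum.inl 0))) (fun _ => r)
  simp only [Formula.Realize, BoundedFormula.realize_rel₁, Term.realize_var, Sum.elim_inl,
    relMap_I_real] at h
  exact h

theorem exists_nsmul_eq (k : ℕ) (x : S) : ∃ y : S, (k + 1) • y = x := by
  have h := S.emb.map_formula (α := Empty) (∀' ∃' ((multTerm (&1) k) =' (&0))) Empty.elim
  simp only [Formula.Realize, BoundedFormula.realize_all, BoundedFormula.realize_ex,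
    BoundedFormula.realize_bdEqual, realize_multTerm, realize_multTerm_real] at h
  exact (h.2 fun a => ⟨a / (k + 1), mul_div_cancel₀ a (by positivity)⟩) x

theorem eq_zero_of_nsmul (k : ℕ) (x : S) (hx : (k + 1) • x = 0) : x = 0 := by
  have h := S.emb.map_formula (α := Fin 1)
    (∀' (((multTerm (&0) k) =' (Term.var (Sum.inl 0))) ⟹ ((&0) =' (Term.var (Sum.inl 0)))))
    (fun _ => 0)
  simp only [Formula.Realize, BoundedFormula.realize_all, BoundedFormula.realize_imp,
    BoundedFormula.realize_bdEqual, realize_multTerm, realize_multTerm_real, Term.realize_var,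
    Sum.elim_inl] at h
  exact (h.2 fun a ha => (mul_eq_zero.1 ha).resolve_left (by positivity)) x hx

theorem memI_add {a b : S} (ha : MemI (2 • a)) (hb : MemI (2 • b)) : MemI (a + b) := by
  have h := S.emb.map_formula (α := Empty) (∀' ∀' ((memIFormula (multTerm (&0) 1)) ⟹
    ((memIFormula (multTerm (&1) 1)) ⟹ (memIFormula (addTerm (&0) (&1)))))) Empty.elim
  simp only [Formula.Realize, BoundedFormula.realize_all, BoundedFormula.realize_imp,
    BoundedFormula.realize_rel₁, realize_multTerm, realize_multTerm_real, realize_addTerm,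
    realize_addTerm_real, relMap_I_real] at h
  refine (h.2 fun a b ha hb => ?_) a b ha hb
  push_cast at ha hb
  constructor <;> linarith

theorem memI_of_nsmul (k : ℕ) {a : S} (ha : MemI ((k + 1) • a)) : MemI a := by
  have h := S.emb.map_formula (α := Empty) (∀' ((memIFormula (multTerm (&0) k)) ⟹
    (memIFormula (&0)))) Empty.elim
  simp only [Formula.Realize, BoundedFormula.realize_all, BoundedFormula.realize_imp,
    BoundedFormula.realize_rel₁, realize_multTerm, realize_multTerm_real, relMap_I_real] at h
  refine (h.2 fun a ha => ?_) a ha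
  have hk : (0 : ℝ) ≤ k := by positivity
  have h0 := nonneg_of_mul_nonneg_right ha.1 (by positivity)
  exact ⟨h0, by nlinarith [mul_nonneg hk h0]⟩

theorem eq_zero_of_memI {x y : S} (hx : MemI x) (hy : MemI y) (hxy : x + y = 0) : x = 0 := by
  have h := S.emb.map_formula (α := Fin 1) (∀' ∀' ((memIFormula (&0)) ⟹ ((memIFormula (&1)) ⟹
    (((addTerm (&0) (&1)) =' (Term.var (Sum.inl 0))) ⟹ ((&0) =' (Term.var (Sum.inl 0)))))))
    (fun _ => 0)
  simp only [Formula.Realize, BoundedFormula.realize_all, BoundedFormula.realize_imp,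
    BoundedFormula.realize_bdEqual, BoundedFormula.realize_rel₁, realize_addTerm,
    realize_addTerm_real, relMap_I_real, Term.realize_var, Sum.elim_inl] at h
  refine (h.2 fun a b ha hb hab => ?_) x y hx hy hxy
  linarith

theorem memI_sub_or {x y : S} (hx : MemI x) (hy : MemI y) : MemI (x - y) ∨ MemI (y - x) := by
  have h := S.emb.map_formula (α := Empty) (∀' ∀' ((memIFormula (&0)) ⟹ ((memIFormula (&1)) ⟹
    ∃' ((((addTerm (&2) (&1)) =' (&0)) ⊔ ((addTerm (&2) (&0)) =' (&1))) ⊓ (memIFormula (&2))))))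
    Empty.elim
  simp only [Formula.Realize, BoundedFormula.realize_all, BoundedFormula.realize_imp,
    BoundedFormula.realize_ex, BoundedFormula.realize_sup, BoundedFormula.realize_inf,
    BoundedFormula.realize_bdEqual, BoundedFormula.realize_rel₁, realize_addTerm,
    realize_addTerm_real, relMap_I_real] at h
  have h' := h.2 fun a b ha hb => by
    rcases le_total a b with hab | hab
    · exact ⟨b - a, Or.inr (sub_add_cancel b a), sub_nonneg.2 hab,
        (sub_le_self b ha.1).trans hb.2⟩
    · exact ⟨a - b, Or.inl (sub_add_cancel a b), sub_nonneg.2 hab,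
        (sub_le_self a hb.1).trans ha.2⟩
  obtain ⟨z, hz | hz, hzI⟩ := h' x y hx hy
  · exact Or.inl (eq_sub_of_add_eq hz ▸ hzI)
  · exact Or.inr (eq_sub_of_add_eq hz ▸ hzI)

theorem memI_one_sub {x : S} (hx : MemI x) : MemI (S.emb 1 - x) := by
  have h := S.emb.map_formula (α := Fin 1) (∀' ((memIFormula (&0)) ⟹
    ∃' (((addTerm (&1) (&0)) =' (Term.var (Sum.inl 0))) ⊓ (memIFormula (&1))))) (fun _ => 1)
  simp only [Formula.Realize, BoundedFormula.realize_all, BoundedFormula.realize_imp,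
    BoundedFormula.realize_ex, BoundedFormula.realize_inf, BoundedFormula.realize_bdEqual,
    BoundedFormula.realize_rel₁, realize_addTerm, realize_addTerm_real, relMap_I_real,
    Term.realize_var, Sum.elim_inl] at h
  have h' := h.2 fun a ha => ⟨1 - a, sub_add_cancel 1 a, sub_nonneg.2 ha.2, sub_le_self 1 ha.1⟩
  obtain ⟨z, hz, hzI⟩ := h' x hx
  exact eq_sub_of_add_eq hz ▸ hzI

/-- Used to show that `x` lies in `I*` as soon as `x` and `e - x` are both in `finiteCone`. -/
theorem memI_of_nsmul_add (k : ℕ) {a b : S} (ha : MemI a) (hb : MemI b)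
    (hab : (k + 1) • (a + b) = S.emb 1) : MemI ((k + 1) • a) := by
  have h := S.emb.map_formula (α := Fin 1) (∀' ∀' ((memIFormula (&0)) ⟹ ((memIFormula (&1)) ⟹
    (((multTerm (addTerm (&0) (&1)) k) =' (Term.var (Sum.inl 0))) ⟹
      (memIFormula (multTerm (&0) k)))))) (fun _ => 1)
  simp only [Formula.Realize, BoundedFormula.realize_all, BoundedFormula.realize_imp,
    BoundedFormula.realize_bdEqual, BoundedFormula.realize_rel₁, realize_addTerm,
    realize_addTerm_real, realize_multTerm, realize_multTerm_real, relMap_I_real,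
    Term.realize_var, Sum.elim_inl] at h
  refine (h.2 fun a b ha hb hab => ?_) a b ha hb hab
  have h1 := mul_nonneg (by positivity : (0 : ℝ) ≤ k + 1) ha.1
  have h2 := mul_nonneg (by positivity : (0 : ℝ) ≤ k + 1) hb.1
  rw [mul_add] at hab
  exact ⟨h1, by linarith⟩

end Transfer

/-! ### Construction of the auxiliary order -/

section Order

/-- A torsion-free abelian group carries a compatible linear order. -/
theorem exists_linearOrder_isOrderedAddMonoid (G : Type*) [AddCommGroup G] [IsAddTorsionFree G] :
    ∃ _ : LinearOrder G, IsOrderedAddMonoid G := by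
  -- Elements are compared lexicographically by their coordinates in a `ℚ`-basis of the divisible
  -- hull, along a chosen well-order of the basis.
  obtain ⟨_, _⟩ := exists_wellFoundedLT (α := Module.Basis.ofVectorSpaceIndex ℚ (DivisibleHull G))
  let b := Module.Basis.ofVectorSpace ℚ (DivisibleHull G)
  let f : G → Lex (Module.Basis.ofVectorSpaceIndex ℚ (DivisibleHull G) →₀ ℚ) :=
    fun x => toLex (b.repr (DivisibleHull.coeAddMonoidHom G x))
  have hf : Function.Injective f :=
    toLex.injective.comp (b.repr.injective.comp DivisibleHull.coe_injective)
  have hadd : ∀ x y, f (x + y) = f x + f y := fun x y => by simp only [f, map_add, toLex_add]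
  let lo : LinearOrder G := LinearOrder.lift' f hf
  refine ⟨lo, { add_le_add_left := fun x y hxy z => ?_ }⟩
  change f (x + z) ≤ f (y + z)
  rw [hadd, hadd]
  have hxy' : f x ≤ f y := hxy
  gcongr

variable (S : ElementaryExtension.{u})

instance : IsAddTorsionFree S where
  nsmul_right_injective n hn x y hxy := by
    obtain ⟨k, rfl⟩ := Nat.exists_eq_succ_of_ne_zero hn
    exact sub_eq_zero.1 (eq_zero_of_nsmul S k _ ((nsmul_sub x y _).trans (sub_eq_zero.2 hxy)))

/-- The submonoid of nonnegative elements in the convex hull of the standard reals. -/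
def finiteCone : AddSubmonoid S where
  carrier := {x | ∃ (k : ℕ) (a : S), MemI a ∧ (k + 1) • a = x}
  zero_mem' := ⟨0, 0, (memI_emb_iff S 0).2 ⟨le_rfl, zero_le_one⟩, by simp⟩
  add_mem' := by
    rintro _ _ ⟨k, a, ha, rfl⟩ ⟨l, b, hb, rfl⟩
    -- With `a = 2(l+1)a'` and `b = 2(k+1)b'` the sum is `2(k+1)(l+1)(a' + b')`; the factor `2`
    -- keeps `a' + b'` inside `I*`.
    obtain ⟨a', rfl⟩ := exists_nsmul_eq S (2 * l + 1) a
    obtain ⟨b', rfl⟩ := exists_nsmul_eq S (2 * k + 1) b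
    have ha' : MemI (2 • a') := by
      refine memI_of_nsmul S l ?_
      rwa [smul_smul, show (l + 1) * 2 = 2 * l + 1 + 1 by ring]
    have hb' : MemI (2 • b') := by
      refine memI_of_nsmul S k ?_
      rwa [smul_smul, show (k + 1) * 2 = 2 * k + 1 + 1 by ring]
    refine ⟨2 * k * l + 2 * k + 2 * l + 1, a' + b', memI_add S ha' hb', ?_⟩
    rw [smul_add, smul_smul, smul_smul]
    congr 2 <;> ring

/-- A common denominator reduces questions about the cone to questions inside `I*`, where transfer
answers them. -/
theorem exists_common_nsmul {x y : S} (hx : x ∈ finiteCone S) (hy : y ∈ finiteCone S) :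
    ∃ (k : ℕ) (a b : S), MemI a ∧ MemI b ∧ (k + 1) • a = x ∧ (k + 1) • b = y := by
  obtain ⟨k, a, ha, rfl⟩ := hx
  obtain ⟨l, b, hb, rfl⟩ := hy
  obtain ⟨a', rfl⟩ := exists_nsmul_eq S l a
  obtain ⟨b', rfl⟩ := exists_nsmul_eq S k b
  refine ⟨k * l + k + l, a', b', memI_of_nsmul S l ha, memI_of_nsmul S k hb, ?_, ?_⟩ <;>
  · rw [smul_smul]
    congr 1
    ring

theorem eq_zero_of_mem_finiteCone {x : S} (hx : x ∈ finiteCone S) (hx' : -x ∈ finiteCone S) :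
    x = 0 := by
  obtain ⟨k, a, b, ha, hb, rfl, h⟩ := exists_common_nsmul S hx hx'
  have h2 : (k + 1) • (a + b) = 0 := by rw [smul_add, h, add_neg_cancel]
  rw [eq_zero_of_memI S ha hb (eq_zero_of_nsmul S k _ h2), smul_zero]

theorem sub_mem_finiteCone_or {x y : S} (hx : x ∈ finiteCone S) (hy : y ∈ finiteCone S) :
    x - y ∈ finiteCone S ∨ -(x - y) ∈ finiteCone S := by
  obtain ⟨k, a, b, ha, hb, rfl, rfl⟩ := exists_common_nsmul S hx hy
  rw [neg_sub, ← smul_sub, ← smul_sub]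
  exact (memI_sub_or S ha hb).imp (fun h => ⟨k, _, h, rfl⟩) (fun h => ⟨k, _, h, rfl⟩)

/-- The convex hull of the standard reals. -/
def finiteElements : AddSubgroup S where
  carrier := {x | x ∈ finiteCone S ∨ -x ∈ finiteCone S}
  zero_mem' := Or.inl (zero_mem _)
  neg_mem' := by
    rintro x (h | h)
    · exact Or.inr (by rwa [neg_neg])
    · exact Or.inl h
  add_mem' := by
    rintro x y (hx | hx) (hy | hy)
    · exact Or.inl (add_mem hx hy)
    · simpa using sub_mem_finiteCone_or S hx hy
    · simpa [add_comm] using sub_mem_finiteCone_or S hy hx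
    · exact Or.inr (by rw [neg_add]; exact add_mem hx hy)

/-- This purity makes the quotient by `finiteElements` torsion-free, hence orderable. -/
theorem mem_finiteElements_of_nsmul {k : ℕ} {x : S} (hx : (k + 1) • x ∈ finiteElements S) :
    x ∈ finiteElements S := by
  have key : ∀ y : S, (k + 1) • y ∈ finiteCone S → y ∈ finiteCone S := by
    rintro y ⟨l, a, ha, h⟩
    obtain ⟨b, rfl⟩ := exists_nsmul_eq S k a
    refine ⟨l, b, memI_of_nsmul S k ha, nsmul_right_injective k.succ_ne_zero ?_⟩
    change (k + 1) • (l + 1) • b = (k + 1) • y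
    rw [← h, smul_comm]
  exact hx.imp (key x) fun h => key (-x) (by rwa [smul_neg])

instance : IsAddTorsionFree (S ⧸ finiteElements S) where
  nsmul_right_injective n hn x y hxy := by
    obtain ⟨k, rfl⟩ := Nat.exists_eq_succ_of_ne_zero hn
    rw [← sub_eq_zero]
    replace hxy : (k + 1) • (x - y) = 0 := (nsmul_sub x y _).trans (sub_eq_zero.2 hxy)
    generalize x - y = z at hxy
    induction z using QuotientAddGroup.induction_on with
    | H z =>
      rw [← QuotientAddGroup.mk_nsmul, QuotientAddGroup.eq_zero_iff] at hxy
      rw [QuotientAddGroup.eq_zero_iff]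
      exact mem_finiteElements_of_nsmul S hxy

/-- The nonnegative elements for a lexicographic order. -/
def lexCone [LinearOrder (S ⧸ finiteElements S)] [IsOrderedAddMonoid (S ⧸ finiteElements S)] :
    AddGroupCone S where
  carrier := {x | 0 < (x : S ⧸ finiteElements S) ∨ x ∈ finiteCone S}
  zero_mem' := Or.inr (zero_mem _)
  add_mem' := by
    have h0 : ∀ y ∈ finiteCone S, (y : S ⧸ finiteElements S) = 0 := fun y hy =>
      (QuotientAddGroup.eq_zero_iff y).2 (Or.inl hy)
    rintro x y (hx | hx) (hy | hy)
    · exact Or.inl (by rw [QuotientAddGroup.mk_add]; exact add_pos hx hy)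
    · exact Or.inl (by rwa [QuotientAddGroup.mk_add, h0 y hy, add_zero])
    · exact Or.inl (by rwa [QuotientAddGroup.mk_add, h0 x hx, zero_add])
    · exact Or.inr (add_mem hx hy)
  eq_zero_of_mem_of_neg_mem' := by
    have h0 : ∀ y ∈ finiteCone S, (y : S ⧸ finiteElements S) = 0 := fun y hy =>
      (QuotientAddGroup.eq_zero_iff y).2 (Or.inl hy)
    rintro x (hx | hx) (hy | hy)
    · rw [QuotientAddGroup.mk_neg] at hy
      exact absurd hx (neg_pos.1 hy).not_gt
    · have := h0 _ hy
      rw [QuotientAddGroup.mk_neg, neg_eq_zero] at this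
      exact absurd this hx.ne'
    · rw [QuotientAddGroup.mk_neg, h0 x hx, neg_zero] at hy
      exact absurd hy (lt_irrefl _)
    · exact eq_zero_of_mem_finiteCone S hx hy

/-- Every elementary extension of `(ℝ, +, [0, 1])` carries a compatible linear order for which
`I*` is an interval. -/
theorem exists_isIntervalGroup :
    ∃ (_ : LinearOrder S) (_ : IsOrderedAddMonoid S), IsIntervalGroup S (S.emb 1) := by
  classical
  obtain ⟨_, _⟩ := exists_linearOrder_isOrderedAddMonoid (S ⧸ finiteElements S)
  let C := lexCone S
  have hC : ∀ x : S, x ∈ C ↔ 0 < (x : S ⧸ finiteElements S) ∨ x ∈ finiteCone S :=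
    fun _ => Iff.rfl
  have : HasMemOrNegMem C := ⟨fun x => by
    rw [hC, hC, QuotientAddGroup.mk_neg]
    rcases lt_trichotomy (x : S ⧸ finiteElements S) 0 with h | h | h
    · exact Or.inr (Or.inl (neg_pos.2 h))
    · exact ((QuotientAddGroup.eq_zero_iff x).1 h).imp Or.inr Or.inr
    · exact Or.inl (Or.inl h)⟩
  let lo : LinearOrder S := LinearOrder.mkOfAddGroupCone C
  have hmon : IsOrderedAddMonoid S := IsOrderedAddMonoid.mkOfCone C
  have hle : ∀ x y : S, x ≤ y ↔ y - x ∈ C := fun _ _ => Iff.rfl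
  have h01 : MemI (S.emb 1) := (memI_emb_iff S 1).2 ⟨zero_le_one, le_rfl⟩
  have hI : ∀ x : S, MemI x → x ∈ finiteCone S := fun x hx => ⟨0, x, hx, by simp⟩
  have hfin : ∀ x : S, x ∈ finiteCone S → (x : S ⧸ finiteElements S) = 0 := fun x hx =>
    (QuotientAddGroup.eq_zero_iff x).2 (Or.inl hx)
  refine ⟨lo, hmon, ⟨?_, ?_, ?_, ?_⟩⟩
  · intro v
    change _ = Structure.funMap (L := Lang) Func.add ![v 0, v 1]
    congr 1
    funext i
    fin_cases i <;> rfl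
  · intro v
    have hv : v = ![v 0] := by
      funext i
      rw [Subsingleton.elim i 0]
      rfl
    rw [hv]
    change MemI (v 0) ↔ v 0 - 0 ∈ C ∧ S.emb 1 - v 0 ∈ C
    generalize v 0 = x
    rw [sub_zero]
    constructor
    · exact fun hx => ⟨Or.inr (hI _ hx), Or.inr (hI _ (memI_one_sub S hx))⟩
    · rintro ⟨h1, h2⟩
      -- Since `e` is finite, `0 ≤ x ≤ e` squeezes the class of `x` to `0`; both inequalities are
      -- then statements about `finiteCone`.
      have hq : (x : S ⧸ finiteElements S) = 0 := by
        refine le_antisymm ?_ ?_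
        · rcases h2 with h2 | h2
          · rw [QuotientAddGroup.mk_sub, hfin _ (hI _ h01), zero_sub] at h2
            exact (neg_pos.1 h2).le
          · have := hfin _ h2
            rw [QuotientAddGroup.mk_sub, hfin _ (hI _ h01), zero_sub, neg_eq_zero] at this
            exact this.le
        · rcases h1 with h1 | h1
          · exact h1.le
          · exact (hfin _ h1).ge
      rw [hC, hq] at h1
      rw [hC, QuotientAddGroup.mk_sub, hfin _ (hI _ h01), hq, sub_zero] at h2
      obtain ⟨k, a, b, ha, hb, rfl, hab⟩ := exists_common_nsmul S
        (h1.resolve_left (lt_irrefl _)) (h2.resolve_left (lt_irrefl _))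
      exact memI_of_nsmul_add S k ha hb (by rw [smul_add, hab, add_sub_cancel])
  · refine lt_of_le_of_ne ?_ ?_
    · rw [hle, sub_zero]
      exact Or.inr (hI _ h01)
    · exact fun h => zero_ne_one (S.emb.injective (h : S.emb 0 = S.emb 1))
  · intro k x hk
    obtain ⟨n, rfl⟩ : ∃ n : ℕ, k = ((n + 1 : ℕ) : ℤ) := ⟨k.toNat - 1, by omega⟩
    obtain ⟨y, hy⟩ := exists_nsmul_eq S n x
    exact ⟨y, by rw [natCast_zsmul, hy]⟩

end Order

end UnitIntervalGroup

namespace UnitIntervalGroup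

/-! ### Automorphisms as group homomorphisms preserving `I*` -/

section Automorphisms

variable {S : ElementaryExtension.{u}}

theorem incl_apply (r : ℝ) : incl S r = S.emb r := rfl

/-- An automorphism as a homomorphism of groups. -/
noncomputable def autAddMonoidHom (σ : S ≃[Lang] S) : S →+ S :=
  AddMonoidHom.mk' σ fun x y => by
    have h := σ.map_fun (Func.add : Lang.Functions 2) ![x, y]
    have h2 : (σ ∘ ![x, y]) = ![σ x, σ y] := by
      funext i
      fin_cases i <;> rfl
    rwa [h2] at h

theorem autAddMonoidHom_apply (σ : S ≃[Lang] S) (x : S) : autAddMonoidHom σ x = σ x := rfl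

theorem memI_aut_iff (σ : S ≃[Lang] S) (x : S) : MemI (autAddMonoidHom σ x) ↔ MemI x := by
  have h := σ.map_rel (Rel.I : Lang.Relations 1) ![x]
  have h2 : (σ ∘ ![x]) = ![σ x] := by
    funext i
    rw [Subsingleton.elim i 0]
    rfl
  rwa [h2] at h

theorem isInvariant_of_forall_mem {X : Set S} (h : ∀ σ : S ≃[Lang] S, ∀ x ∈ X, σ x ∈ X) :
    IsInvariant Lang X := fun σ => by
  refine Set.Subset.antisymm ?_ fun x hx => ⟨σ.symm x, h _ _ hx, σ.apply_symm_apply x⟩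
  rintro _ ⟨x, hx, rfl⟩
  exact h σ x hx

theorem IsInvariant.aut_mem {X : Set S} (hX : IsInvariant Lang X) (σ : S ≃[Lang] S) {x : S}
    (hx : x ∈ X) : σ x ∈ X :=
  hX σ ▸ Set.mem_image_of_mem σ hx

theorem IsTypeDefinable.isInvariant {X : Set S} (hX : IsTypeDefinable Lang X) :
    IsInvariant Lang X := by
  obtain ⟨p, rfl⟩ := hX
  refine isInvariant_of_forall_mem fun σ x hx φ hφ => ?_
  have := StrongHomClass.realize_formula σ φ (v := fun _ => x)
  exact this.2 (hx φ hφ)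

theorem zsmul_emb (k : ℤ) (r : ℝ) : k • S.emb r = S.emb (k * r) := by
  rw [← incl_apply, ← incl_apply, ← map_zsmul, zsmul_eq_mul]

theorem nsmul_emb (k : ℕ) (r : ℝ) : k • S.emb r = S.emb (k * r) := by
  rw [← incl_apply, ← incl_apply, ← map_nsmul, nsmul_eq_mul]

theorem mem_rationals_of_affine_eq_zero {x : S} {c d : ℤ} (hc : 0 < c)
    (h : c • x + d • S.emb 1 = 0) : x ∈ rationals S := by
  refine ⟨-d / c, ?_⟩
  refine zsmul_right_injective hc.ne' ?_
  change c • S.emb ((-d / c : ℚ) : ℝ) = c • x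
  have hc' : (c : ℝ) ≠ 0 := by exact_mod_cast hc.ne'
  rw [zsmul_emb, eq_neg_of_add_eq_zero_left h, ← neg_smul, zsmul_emb]
  congr 1
  push_cast
  field_simp

end Automorphisms

/-! ### Infinitesimals and standard parts in terms of the order -/

section Ordered

variable {S : ElementaryExtension.{u}} [LinearOrder S]

theorem memI_iff (hV : IsIntervalGroup S (S.emb 1)) (x : S) : MemI x ↔ 0 ≤ x ∧ x ≤ S.emb 1 :=
  hV.relMap_I ![x]

variable [IsOrderedAddMonoid S]

theorem emb_strictMono (hV : IsIntervalGroup S (S.emb 1)) : StrictMono S.emb := by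
  have h0 : ∀ r : ℝ, 0 ≤ r → 0 ≤ S.emb r := fun r hr => by
    obtain ⟨n, hn⟩ := exists_nat_ge r
    have hn0 : (0 : ℝ) < n + 1 := by positivity
    have h1 : MemI (S.emb (r / (n + 1))) :=
      (memI_emb_iff S _).2 ⟨by positivity, (div_le_one hn0).2 (by linarith)⟩
    have h2 : S.emb r = (n + 1) • S.emb (r / (n + 1)) := by
      rw [← incl_apply, ← incl_apply, ← map_nsmul, nsmul_eq_mul]
      congr 1
      push_cast
      field_simp
    rw [h2]
    exact nsmul_nonneg ((memI_iff hV _).1 h1).1 _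
  refine Monotone.strictMono_of_injective (fun r s hrs => ?_) S.emb.injective
  rw [← sub_nonneg, ← incl_apply, ← incl_apply, ← map_sub]
  exact h0 _ (sub_nonneg.2 hrs)

theorem realize_intervalFormula_iff (hV : IsIntervalGroup S (S.emb 1)) (k : ℕ) (x : S) :
    (intervalFormula k).Realize (fun _ => x) ↔ (k + 1) • |x| ≤ S.emb 1 := by
  have h : (intervalFormula k).Realize (fun _ => x) ↔
      ∃ w : S, MemI ((k + 1) • x) ∨ ((x + w) + (x + w) = x + w ∧ MemI ((k + 1) • w)) := by
    simp only [intervalFormula, Formula.Realize, BoundedFormula.realize_ex,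
      BoundedFormula.realize_sup, BoundedFormula.realize_inf, BoundedFormula.realize_bdEqual,
      BoundedFormula.realize_rel₁, realize_addTerm, realize_multTerm, Term.realize_var,
      Sum.elim_inl]
    rfl
  rw [h]
  simp only [memI_iff hV, add_eq_left]
  constructor
  · rintro ⟨w, ⟨h1, h2⟩ | ⟨hw, h1, h2⟩⟩
    · rwa [← abs_nsmul, abs_of_nonneg h1]
    · rw [eq_neg_of_add_eq_zero_left hw, abs_neg, ← abs_nsmul, abs_of_nonneg h1]
      exact h2
  · intro hx
    refine ⟨-x, ?_⟩
    rcases le_total 0 x with h0 | h0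
    · rw [abs_of_nonneg h0] at hx
      exact Or.inl ⟨nsmul_nonneg h0 _, hx⟩
    · rw [abs_of_nonpos h0] at hx
      exact Or.inr ⟨add_neg_cancel x, nsmul_nonneg (neg_nonneg.2 h0) _, hx⟩

theorem mem_infinitesimals_iff (hV : IsIntervalGroup S (S.emb 1)) (x : S) :
    x ∈ infinitesimals S ↔ ∀ n : ℕ, n • |x| ≤ S.emb 1 := by
  change x ∈ ⋂ (n : ℕ) (_ : 0 < n), star S (Set.Icc (-(1 / (n : ℝ))) (1 / (n : ℝ))) ↔ _
  simp only [Set.mem_iInter]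
  constructor
  · rintro h (_ | n)
    · simpa using hV.unit_pos.le
    · have := h (n + 1) n.succ_pos
      rwa [mem_star_iff S (defines_intervalFormula (n + 1) n.succ_pos),
        realize_intervalFormula_iff hV] at this
  · intro h n hn
    rw [mem_star_iff S (defines_intervalFormula n hn), realize_intervalFormula_iff hV]
    exact h _

theorem zsmul_lt_of_mem_infinitesimals (hV : IsIntervalGroup S (S.emb 1)) {x : S}
    (hx : x ∈ infinitesimals S) (k : ℤ) : k • x < S.emb 1 := by
  -- Doubling the multiple turns the weak bound defining `μ` into a strict one.
  have h := (mem_infinitesimals_iff hV x).1 hx (2 * k.natAbs)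
  have h1 : k • x ≤ k.natAbs • |x| := by
    refine (le_abs_self _).trans ?_
    rw [abs_zsmul, Int.abs_eq_natAbs, natCast_zsmul]
  rw [mul_smul, two_nsmul] at h
  by_contra! h2
  exact (add_pos_of_pos_of_nonneg hV.unit_pos le_rfl).not_ge
    (by simpa using (add_le_add (h2.trans h1) (h2.trans h1)).trans h)

theorem emb_mem_infinitesimals_iff (hV : IsIntervalGroup S (S.emb 1)) (r : ℝ) :
    S.emb r ∈ infinitesimals S ↔ r = 0 := by
  refine ⟨fun h => ?_, fun h => h ▸ zero_mem _⟩
  have key : ∀ k : ℤ, k * r < 1 := fun k => by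
    have := zsmul_lt_of_mem_infinitesimals hV h k
    rwa [zsmul_emb, (emb_strictMono hV).lt_iff_lt] at this
  by_contra h0
  obtain ⟨n, hn⟩ := exists_nat_ge |r|⁻¹
  have hr : 0 < |r| := abs_pos.2 h0
  have h1 : 1 ≤ n * |r| := by rwa [inv_le_iff_one_le_mul₀ hr] at hn
  rcases abs_choice r with h | h <;> rw [h] at h1
  · exact (key n).not_ge (by exact_mod_cast h1)
  · exact (key (-n)).not_ge (by push_cast; linarith)

/-- The standard part is the supremum of the reals below `x`. -/
theorem exists_sub_mem_infinitesimals (hV : IsIntervalGroup S (S.emb 1)) {x : S} {n : ℕ}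
    (hx : |x| ≤ n • S.emb 1) : ∃ r : ℝ, x - S.emb r ∈ infinitesimals S := by
  have hmono := emb_strictMono hV
  rw [nsmul_emb, mul_one, abs_le', ← incl_apply, neg_le, ← map_neg, incl_apply, incl_apply] at hx
  let s : Set ℝ := {r | S.emb r ≤ x}
  have hbdd : BddAbove s := ⟨n, fun r hr => hmono.le_iff_le.1 (le_trans hr hx.1)⟩
  have hne : s.Nonempty := ⟨-n, hx.2⟩
  refine ⟨sSup s, (mem_infinitesimals_iff hV _).2 fun m => ?_⟩
  rcases Nat.eq_zero_or_pos m with rfl | hm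
  · simpa using hV.unit_pos.le
  have hm' : (0 : ℝ) < m := by exact_mod_cast hm
  have hpos : (0 : ℝ) < 1 / m := by positivity
  have h1 : x - S.emb (sSup s) ≤ S.emb (1 / m) := by
    rw [sub_le_iff_le_add, ← emb_add]
    by_contra! h
    have := le_csSup hbdd (show 1 / (m : ℝ) + sSup s ∈ s from h.le)
    linarith
  have h2 : -(x - S.emb (sSup s)) ≤ S.emb (1 / m) := by
    obtain ⟨t, ht, ht'⟩ := exists_lt_of_lt_csSup hne (sub_lt_self (sSup s) hpos)
    rw [neg_sub, sub_le_iff_le_add]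
    refine le_trans ?_ (add_le_add_right (show S.emb t ≤ x from ht) _)
    rw [← emb_add, hmono.le_iff_le]
    linarith
  calc m • |x - S.emb (sSup s)| ≤ m • S.emb (1 / m) := by
        have := abs_le'.2 ⟨h1, h2⟩
        gcongr
    _ = S.emb 1 := by rw [nsmul_emb, mul_one_div_cancel hm'.ne']

end Ordered
end UnitIntervalGroup

namespace UnitIntervalGroup

/-! ### Conjugacy, and what invariance forces on a subgroup -/

variable {S : ElementaryExtension.{u}} [LinearOrder S] [IsOrderedAddMonoid S]

/-- Elements with the same nonzero affine signs are conjugate. -/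
theorem exists_aut_apply_eq (hV : IsIntervalGroup S (S.emb 1)) (hS : IsMonster Lang S) {x y : S}
    (h0 : ∀ c d : ℤ, 0 < c → c • x + d • S.emb 1 ≠ 0)
    (hpos : ∀ c d : ℤ, 0 < c → 0 < c • x + d • S.emb 1 → 0 < c • y + d • S.emb 1)
    (hneg : ∀ c d : ℤ, 0 < c → c • x + d • S.emb 1 < 0 → c • y + d • S.emb 1 < 0) :
    ∃ σ : S ≃[Lang] S, σ x = y := by
  -- No form with `c > 0` vanishes at `x`, so the two implications cover all cases and become
  -- equivalences. Negative `c` follows by changing signs, and `c = 0` does not involve `x`.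
  have hcd : ∀ c d : ℤ, 0 < c → (0 < c • x + d • S.emb 1 ↔ 0 < c • y + d • S.emb 1) :=
    fun c d hc => ⟨hpos c d hc, fun h => (lt_or_gt_of_ne (h0 c d hc)).resolve_left
      fun h' => (hneg c d hc h').not_gt h⟩
  have hcd' : ∀ c d : ℤ, 0 < c → (c • x + d • S.emb 1 < 0 ↔ c • y + d • S.emb 1 < 0) :=
    fun c d hc => ⟨hneg c d hc, fun h => (lt_or_gt_of_ne (h0 c d hc)).resolve_right
      fun h' => (hpos c d hc h').not_gt h⟩
  have hall : ∀ c d : ℤ, 0 < c • x + d • S.emb 1 ↔ 0 < c • y + d • S.emb 1 := by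
    intro c d
    rcases lt_trichotomy c 0 with hc | rfl | hc
    · have := hcd' (-c) (-d) (by omega)
      rwa [neg_smul, neg_smul, neg_smul, ← neg_add, ← neg_add, neg_lt_zero, neg_lt_zero] at this
    · simp
    · exact hcd c d hc
  obtain ⟨κ, -, hκ, -, hhom⟩ := hS
  obtain ⟨σ, hσ⟩ := hhom {x} (by
    rw [Cardinal.mk_singleton]
    refine lt_of_le_of_lt ?_ hκ
    rw [← Cardinal.lift_one.{0, u}, Cardinal.lift_le]
    -- By quantifier elimination, equal signs of all forms make `x ↦ y` a partial elementary map.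
    exact Cardinal.one_le_aleph0.trans (le_max_left _ _)) (fun _ => y) (fun φ => by
      obtain ⟨N, -, hN⟩ := exists_agree_realize_iff hV φ
      refine hN _ _ _ _ fun c d _ _ => ?_
      simp only [affine, Fintype.sum_sum_type, Sum.elim_inl, Finset.univ_unique,
        Finset.sum_singleton, Finset.univ_eq_empty, Finset.sum_empty, add_zero,
        Set.default_coe_singleton]
      exact hall _ _)
  exact ⟨σ, hσ ⟨x, rfl⟩⟩

/-- At a positive infinite element every form with `c > 0` is positive, so all such elements are
conjugate; every element of the group is a difference of two of them. -/
theorem eq_top_of_infinite_mem (hV : IsIntervalGroup S (S.emb 1)) (hS : IsMonster Lang S)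
    {H : AddSubgroup S} (hH : IsInvariant Lang (H : Set S)) {x : S} (hx : x ∈ H)
    (hinf : ∀ n : ℕ, n • S.emb 1 < |x|) : H = ⊤ := by
  have hx' : |x| ∈ H := by
    rcases abs_choice x with h | h <;> rw [h]
    · exact hx
    · exact neg_mem hx
  have hsign : ∀ y : S, (∀ n : ℕ, n • S.emb 1 < y) → ∀ c d : ℤ, 0 < c →
      0 < c • y + d • S.emb 1 := by
    intro y hy c d hc
    have hy0 : 0 ≤ y := by simpa using (hy 0).le
    have h1 : y ≤ c • y := by
      simpa using zsmul_le_zsmul_left hy0 (show 1 ≤ c by omega)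
    have h2 : (-d) • S.emb 1 ≤ d.natAbs • S.emb 1 := by
      rw [← natCast_zsmul]
      exact zsmul_le_zsmul_left hV.unit_pos.le (by omega)
    rw [← neg_lt_iff_pos_add, ← neg_smul]
    exact (h2.trans_lt (hy _)).trans_le h1
  have hmem : ∀ y : S, (∀ n : ℕ, n • S.emb 1 < y) → y ∈ H := fun y hy => by
    obtain ⟨σ, rfl⟩ := exists_aut_apply_eq hV hS (y := y)
      (fun c d hc => (hsign _ hinf c d hc).ne') (fun c d hc _ => hsign y hy c d hc)
      (fun c d hc h => absurd h (hsign _ hinf c d hc).not_gt)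
    exact hH.aut_mem σ hx'
  refine eq_top_iff.2 fun z _ => ?_
  have h1 : |x| + (|z| + z) ∈ H := hmem _ fun n => (hinf n).trans_le
    (le_add_of_nonneg_right (neg_le_iff_add_nonneg.1 (neg_le_abs z)))
  have h2 : |x| + |z| ∈ H := hmem _ fun n => (hinf n).trans_le
    (le_add_of_nonneg_right (abs_nonneg z))
  have : z = (|x| + (|z| + z)) - (|x| + |z|) := by abel
  rw [this]
  exact sub_mem h1 h2

/-- For infinitesimal `δ ≥ 0`, at least one of `x + δ`, `x - δ` is in the cut of `x` over the
rationals: two distinct rationals cannot both lie within `δ` of `x`. That element is conjugate to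
`x`, and its difference from `x` is `±δ`. -/
theorem infinitesimals_le_of_irrational_mem (hV : IsIntervalGroup S (S.emb 1))
    (hS : IsMonster Lang S) {H : AddSubgroup S} (hH : IsInvariant Lang (H : Set S)) {x : S}
    (hx : x ∈ H) (h0 : ∀ c d : ℤ, 0 < c → c • x + d • S.emb 1 ≠ 0) : infinitesimals S ≤ H := by
  have key : ∀ δ ∈ infinitesimals S, 0 ≤ δ → δ ∈ H := by
    intro δ hδ hδ0
    by_cases hcase : ∀ c d : ℤ, 0 < c → c • x + d • S.emb 1 < 0 → c • (x + δ) + d • S.emb 1 < 0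
    · obtain ⟨σ, hσ⟩ := exists_aut_apply_eq hV hS h0 (y := x + δ) (fun c d hc h => by
        rw [smul_add, add_right_comm]
        exact add_pos_of_pos_of_nonneg h (zsmul_nonneg hδ0 hc.le)) hcase
      have h1 := hH.aut_mem σ hx
      rw [hσ] at h1
      simpa using sub_mem h1 hx
    · push Not at hcase
      obtain ⟨c, d, hc, hneg, hle⟩ := hcase
      obtain ⟨σ, hσ⟩ := exists_aut_apply_eq hV hS h0 (y := x - δ) (fun c' d' hc' hpos => by
        by_contra! h
        -- Rationals `q = -d/c` and `q' = -d'/c'` would satisfy `x - δ ≤ q' < x < q ≤ x + δ`. Then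
        -- `q - q'` is a positive integer over `c c'`, which forces `e ≤ 2 c c' δ`, impossible for
        -- infinitesimal `δ`.
        have e1 : (c * d' - c' * d) • S.emb 1 =
            c • (c' • x + d' • S.emb 1) + c' • -(c • x + d • S.emb 1) := by module
        have h1 : 0 < (c * d' - c' * d) • S.emb 1 := by
          rw [e1]
          exact add_pos (zsmul_pos hpos hc) (zsmul_pos (neg_pos.2 hneg) hc')
        have h2 : 1 ≤ c * d' - c' * d := by
          by_contra! h
          exact h1.not_ge (by
            simpa using zsmul_le_zsmul_left hV.unit_pos.le (show _ ≤ (0 : ℤ) by omega))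
        have h3 : S.emb 1 ≤ (c * d' - c' * d) • S.emb 1 := by
          simpa using zsmul_le_zsmul_left hV.unit_pos.le h2
        refine (zsmul_lt_of_mem_infinitesimals hV hδ (2 * (c * c'))).not_ge (h3.trans ?_)
        rw [e1, ← sub_nonneg]
        have e2 : (2 * (c * c')) • δ -
            (c • (c' • x + d' • S.emb 1) + c' • -(c • x + d • S.emb 1)) =
            c • -(c' • (x - δ) + d' • S.emb 1) + c' • (c • (x + δ) + d • S.emb 1) := by module
        rw [e2]
        exact add_nonneg (zsmul_nonneg (neg_nonneg.2 h) hc.le) (zsmul_nonneg hle hc'.le))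
        (fun c' d' hc' h => by
          rw [smul_sub, sub_add_eq_add_sub]
          exact (sub_le_self _ (zsmul_nonneg hδ0 hc'.le)).trans_lt h)
      have h1 := hH.aut_mem σ hx
      rw [hσ] at h1
      simpa using sub_mem hx h1
  intro δ hδ
  rcases le_total 0 δ with h | h
  · exact key δ hδ h
  · simpa using neg_mem (key (-δ) (neg_mem hδ) (neg_nonneg.2 h))

theorem eq_sup_map_of_infinitesimals_le (hV : IsIntervalGroup S (S.emb 1)) {H : AddSubgroup S}
    (hμ : infinitesimals S ≤ H) (hfin : ∀ x ∈ H, ∃ n : ℕ, |x| ≤ n • S.emb 1) :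
    H = infinitesimals S ⊔ (H.comap (incl S)).map (incl S) := by
  refine le_antisymm (fun x hx => ?_) (sup_le hμ (AddSubgroup.map_comap_le _ _))
  obtain ⟨n, hn⟩ := hfin x hx
  obtain ⟨r, hr⟩ := exists_sub_mem_infinitesimals hV hn
  refine AddSubgroup.mem_sup.2 ⟨_, hr, S.emb r, ⟨r, ?_, rfl⟩, sub_add_cancel _ _⟩
  change S.emb r ∈ H
  simpa using sub_mem hx (hμ hr)

theorem IsInvariant.cases (hV : IsIntervalGroup S (S.emb 1)) (hS : IsMonster Lang S)
    {H : AddSubgroup S} (hH : IsInvariant Lang (H : Set S)) :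
    H ≤ rationals S ∨ (∃ R : AddSubgroup ℝ, H = infinitesimals S ⊔ R.map (incl S)) ∨ H = ⊤ := by
  by_cases hinf : ∃ x ∈ H, ∀ n : ℕ, n • S.emb 1 < |x|
  · obtain ⟨x, hx, hinf⟩ := hinf
    exact Or.inr (Or.inr (eq_top_of_infinite_mem hV hS hH hx hinf))
  push Not at hinf
  by_cases hirr : ∃ x ∈ H, ∀ c d : ℤ, 0 < c → c • x + d • S.emb 1 ≠ 0
  · obtain ⟨x, hx, h0⟩ := hirr
    exact Or.inr (Or.inl ⟨_, eq_sup_map_of_infinitesimals_le hV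
      (infinitesimals_le_of_irrational_mem hV hS hH hx h0) hinf⟩)
  · push Not at hirr
    refine Or.inl fun x hx => ?_
    obtain ⟨c, d, hc, h⟩ := hirr x hx
    exact mem_rationals_of_affine_eq_zero hc h

/-! ### Invariance of the listed subgroups -/

section Invariance

/-- The order may not be preserved, so the argument goes through `I*`: `e` is its largest element,
and `u ↦ e - u` maps it to itself. -/
theorem aut_emb_one (hV : IsIntervalGroup S (S.emb 1)) (σ : S ≃[Lang] S) :
    autAddMonoidHom σ (S.emb 1) = S.emb 1 := by
  have h1 : ∀ τ : S ≃[Lang] S, autAddMonoidHom τ (S.emb 1) ≤ S.emb 1 := fun τ =>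
    ((memI_iff hV _).1 ((memI_aut_iff τ _).2 ((memI_iff hV _).2 ⟨hV.unit_pos.le, le_rfl⟩))).2
  refine le_antisymm (h1 σ) ?_
  have h2 : MemI (S.emb 1 - autAddMonoidHom σ.symm (S.emb 1)) :=
    memI_one_sub S ((memI_aut_iff σ.symm _).2 ((memI_iff hV _).2 ⟨hV.unit_pos.le, le_rfl⟩))
  rw [← memI_aut_iff σ, map_sub] at h2
  have h3 : autAddMonoidHom σ (autAddMonoidHom σ.symm (S.emb 1)) = S.emb 1 :=
    σ.apply_symm_apply _
  rw [h3] at h2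
  exact sub_nonneg.1 ((memI_iff hV _).1 h2).1

theorem aut_eq_of_mem_rationals (hV : IsIntervalGroup S (S.emb 1)) (σ : S ≃[Lang] S) {x : S}
    (hx : x ∈ rationals S) : autAddMonoidHom σ x = x := by
  obtain ⟨q, rfl⟩ := hx
  change autAddMonoidHom σ (S.emb (q : ℝ)) = S.emb (q : ℝ)
  have h : q.den • S.emb (q : ℝ) = q.num • S.emb 1 := by
    rw [nsmul_emb, zsmul_emb, mul_one]
    congr 1
    exact_mod_cast Rat.den_mul_eq_num q
  refine nsmul_right_injective q.den_nz ?_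
  change q.den • autAddMonoidHom σ (S.emb (q : ℝ)) = q.den • S.emb (q : ℝ)
  rw [← map_nsmul, h, map_zsmul, aut_emb_one hV]

theorem abs_le_of_aut (hV : IsIntervalGroup S (S.emb 1)) (σ : S ≃[Lang] S) {x : S}
    (hx : |x| ≤ S.emb 1) : |autAddMonoidHom σ x| ≤ S.emb 1 := by
  have key : ∀ y : S, 0 ≤ y → y ≤ S.emb 1 → |autAddMonoidHom σ y| ≤ S.emb 1 := fun y h0 h1 => by
    obtain ⟨h2, h3⟩ := (memI_iff hV _).1 ((memI_aut_iff σ y).2 ((memI_iff hV _).2 ⟨h0, h1⟩))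
    rwa [abs_of_nonneg h2]
  rcases abs_choice x with h | h
  · exact key x (by rw [← h]; exact abs_nonneg x) (h ▸ hx)
  · have := key (-x) (by rw [← h]; exact abs_nonneg x) (h ▸ hx)
    rwa [map_neg, abs_neg] at this

theorem aut_mem_infinitesimals (hV : IsIntervalGroup S (S.emb 1)) (σ : S ≃[Lang] S) {x : S}
    (hx : x ∈ infinitesimals S) : autAddMonoidHom σ x ∈ infinitesimals S := by
  rw [mem_infinitesimals_iff hV] at hx ⊢
  intro n
  rw [← abs_nsmul, ← map_nsmul]
  exact abs_le_of_aut hV σ (by rw [abs_nsmul]; exact hx n)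

/-- For each `n`, both `n r` and its image lie in the translate of `I*` by `⌊n r⌋ e`, which is
fixed; so they differ by at most `e`. -/
theorem aut_emb_sub_mem_infinitesimals (hV : IsIntervalGroup S (S.emb 1)) (σ : S ≃[Lang] S)
    (r : ℝ) : autAddMonoidHom σ (S.emb r) - S.emb r ∈ infinitesimals S := by
  rw [mem_infinitesimals_iff hV]
  intro n
  have h1 : MemI (n • S.emb r - ⌊n * r⌋ • S.emb 1) := by
    rw [nsmul_emb, zsmul_emb, mul_one, ← incl_apply, ← incl_apply, ← map_sub, incl_apply,
      memI_emb_iff]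
    exact ⟨sub_nonneg.2 (Int.floor_le _), by linarith [Int.lt_floor_add_one ((n : ℝ) * r)]⟩
  have h2 := (memI_aut_iff σ _).2 h1
  rw [map_sub, map_zsmul, map_nsmul, aut_emb_one hV, memI_iff hV] at h2
  rw [memI_iff hV] at h1
  rw [← abs_nsmul, smul_sub, ← sub_sub_sub_cancel_right _ _ (⌊n * r⌋ • S.emb 1)]
  exact abs_sub_le_of_nonneg_of_le h2.1 h2.2 h1.1 h1.2

theorem isInvariant_of_le_rationals (hV : IsIntervalGroup S (S.emb 1)) {H : AddSubgroup S}
    (hH : H ≤ rationals S) : IsInvariant Lang (H : Set S) :=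
  isInvariant_of_forall_mem fun σ x hx => by
    rw [← autAddMonoidHom_apply, aut_eq_of_mem_rationals hV σ (hH hx)]
    exact hx

theorem isInvariant_sup_map (hV : IsIntervalGroup S (S.emb 1)) (R : AddSubgroup ℝ) :
    IsInvariant Lang ((infinitesimals S ⊔ R.map (incl S) : AddSubgroup S) : Set S) :=
  isInvariant_of_forall_mem fun σ x hx => by
    obtain ⟨y, hy, _, ⟨r, hr, rfl⟩, rfl⟩ := AddSubgroup.mem_sup.1 hx
    refine AddSubgroup.mem_sup.2 ⟨autAddMonoidHom σ y + (autAddMonoidHom σ (S.emb r) - S.emb r),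
      add_mem (aut_mem_infinitesimals hV σ hy) (aut_emb_sub_mem_infinitesimals hV σ r),
      incl S r, ⟨r, hr, rfl⟩, ?_⟩
    rw [← autAddMonoidHom_apply, map_add, incl_apply]
    abel

/-- The classification of the invariant subgroups. -/
theorem isInvariant_iff (hV : IsIntervalGroup S (S.emb 1)) (hS : IsMonster Lang S)
    (H : AddSubgroup S) : IsInvariant Lang (H : Set S) ↔
      H = ⊥ ∨ H ≤ rationals S ∨
        (∃ R : AddSubgroup ℝ, H = infinitesimals S ⊔ R.map (incl S)) ∨ H = ⊤ := by
  refine ⟨fun h => Or.inr (h.cases hV hS), ?_⟩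
  rintro (rfl | h | ⟨R, rfl⟩ | rfl)
  · exact isInvariant_of_le_rationals hV bot_le
  · exact isInvariant_of_le_rationals hV h
  · exact isInvariant_sup_map hV R
  · exact isInvariant_of_forall_mem fun _ _ _ => trivial

end Invariance
end UnitIntervalGroup

namespace UnitIntervalGroup

/-! ### Subgroups type-definable without parameters -/

section TypeDefinable

variable {S : ElementaryExtension.{u}} [LinearOrder S] [IsOrderedAddMonoid S]

/-- The formula saying that `x` does not lie in `[-(k + 1), k + 1]`. -/
def outsideFormula (k : ℕ) : Lang.Formula (Fin 1) :=
  ∼(∃' ((memIFormula (&0)) ⊓ (((multTerm (&0) k) =' (Term.var (Sum.inl 0))) ⊔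
    ((addTerm (addTerm (Term.var (Sum.inl 0)) (multTerm (&0) k))
      (addTerm (Term.var (Sum.inl 0)) (multTerm (&0) k))) ='
        (addTerm (Term.var (Sum.inl 0)) (multTerm (&0) k))))))

/-- The language has no symbol for zero, so `u + u = u` stands for `u = 0`, and thus `x = -(k + 1)w`
becomes expressible. -/
theorem realize_outsideFormula_iff (hV : IsIntervalGroup S (S.emb 1)) (k : ℕ) (x : S) :
    (outsideFormula k).Realize (fun _ => x) ↔ (k + 1) • S.emb 1 < |x| := by
  have h : (outsideFormula k).Realize (fun _ => x) ↔
      ¬ ∃ w : S, MemI w ∧ ((k + 1) • w = x ∨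
        (x + (k + 1) • w) + (x + (k + 1) • w) = x + (k + 1) • w) := by
    simp only [outsideFormula, Formula.Realize, BoundedFormula.realize_not,
      BoundedFormula.realize_ex, BoundedFormula.realize_sup, BoundedFormula.realize_inf,
      BoundedFormula.realize_bdEqual, BoundedFormula.realize_rel₁, realize_addTerm,
      realize_multTerm, Term.realize_var, Sum.elim_inl]
    rfl
  rw [h, ← not_le, not_iff_not]
  simp only [memI_iff hV, add_eq_left]
  constructor
  · rintro ⟨w, ⟨h1, h2⟩, hw⟩
    have hx : |x| = (k + 1) • w := by
      rcases hw with rfl | hw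
      · exact abs_of_nonneg (nsmul_nonneg h1 _)
      · rw [eq_neg_of_add_eq_zero_left hw, abs_neg]
        exact abs_of_nonneg (nsmul_nonneg h1 _)
    rw [hx]
    gcongr
  · intro hx
    obtain ⟨w, hw⟩ := exists_nsmul_eq S k |x|
    refine ⟨w, ⟨?_, ?_⟩, ?_⟩
    · by_contra! h0
      exact (abs_nonneg x).not_gt (hw ▸ nsmul_neg h0 k.succ_ne_zero)
    · by_contra! h0
      exact hx.not_gt (hw ▸ nsmul_lt_nsmul_right k.succ_ne_zero h0)
    · rw [hw]
      rcases abs_choice x with h | h <;> rw [h]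
      · exact Or.inl rfl
      · exact Or.inr (add_neg_cancel x)

/-- By saturation, a type-definable set with arbitrarily large elements has an infinite element. -/
theorem IsTypeDefinable.exists_infinite (hV : IsIntervalGroup S (S.emb 1))
    (hS : IsMonster Lang S) {X : Set S} (hX : IsTypeDefinable Lang X)
    (hlarge : ∀ n : ℕ, ∃ x ∈ X, n • S.emb 1 < |x|) : ∃ x ∈ X, ∀ n : ℕ, n • S.emb 1 < |x| := by
  obtain ⟨p, rfl⟩ := hX
  obtain ⟨κ, -, hκ, hsat, -⟩ := hS
  let g := (Lang.lhomWithConstants (∅ : Set S)).onFormula (α := Fin 1)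
  obtain ⟨x, hx⟩ := hsat ∅ (by
    rw [Cardinal.mk_eq_zero]
    exact zero_le.trans_lt hκ) (g '' p ∪ Set.range (g ∘ outsideFormula)) (by
    intro p₀ hp₀
    -- A finite part of the type asks only for finitely many lower bounds on `|x|`, so a member of
    -- the set beyond a large `n` realizes it.
    have hev : ∀ᶠ n : ℕ in Filter.atTop, ∀ φ ∈ p₀, ∀ x ∈ {x : S | ∀ φ ∈ p, φ.Realize fun _ => x},
        n • S.emb 1 < |x| → φ.Realize (fun _ => x) := by
      rw [Finset.eventually_all]
      intro φ hφ
      rcases hp₀ hφ with ⟨ψ, hψ, rfl⟩ | ⟨k, rfl⟩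
      · exact Filter.Eventually.of_forall fun n x hx _ => (LHom.realize_onFormula _ ψ).2 (hx ψ hψ)
      · filter_upwards [Filter.eventually_ge_atTop (k + 1)] with n hn x _ hlt
        refine (LHom.realize_onFormula _ _).2 ((realize_outsideFormula_iff hV k x).2 ?_)
        exact (nsmul_le_nsmul_left hV.unit_pos.le hn).trans_lt hlt
    obtain ⟨n, hn⟩ := hev.exists
    obtain ⟨x, hx, hlt⟩ := hlarge n
    exact ⟨x, fun φ hφ => hn φ hφ x hx hlt⟩)
  refine ⟨x, fun φ hφ => (LHom.realize_onFormula _ φ).1 (hx _ (Or.inl ⟨φ, hφ, rfl⟩)), fun n => ?_⟩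
  have := (LHom.realize_onFormula _ _).1 (hx _ (Or.inr ⟨n, rfl⟩))
  exact (nsmul_le_nsmul_left hV.unit_pos.le n.le_succ).trans_lt
    ((realize_outsideFormula_iff hV n x).1 this)

/-- If `n |x| > e`, then `(m + 1) n x` exceeds `m e` in absolute value for every `m`, which feeds
the saturation argument. -/
theorem IsTypeDefinable.eq_top (hV : IsIntervalGroup S (S.emb 1)) (hS : IsMonster Lang S)
    {H : AddSubgroup S} (hH : IsTypeDefinable Lang (H : Set S)) {x : S} (hx : x ∈ H)
    (hxμ : x ∉ infinitesimals S) : H = ⊤ := by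
  rw [mem_infinitesimals_iff hV] at hxμ
  push Not at hxμ
  obtain ⟨n, hn⟩ := hxμ
  obtain ⟨y, hy, hinf⟩ := hH.exists_infinite hV hS fun m => ⟨((m + 1) * n) • x, nsmul_mem hx _, by
    rw [abs_nsmul, mul_smul]
    exact (nsmul_lt_nsmul_left hV.unit_pos m.lt_succ_self).trans
      (nsmul_lt_nsmul_right m.succ_ne_zero hn)⟩
  exact eq_top_of_infinite_mem hV hS hH.isInvariant hy hinf

/-- The formula saying that `x = 0`. -/
def zeroFormula : Lang.Formula (Fin 1) :=
  (addTerm (Term.var 0) (Term.var 0)).equal (Term.var 0)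

theorem realize_zeroFormula_iff (S : ElementaryExtension.{u}) (v : Fin 1 → S) :
    zeroFormula.Realize v ↔ v 0 = 0 := by
  rw [zeroFormula, Formula.realize_equal, realize_addTerm, Term.realize_var, add_eq_left]

/-- The classification of the subgroups that are type-definable without parameters. -/
theorem isTypeDefinable_iff (hV : IsIntervalGroup S (S.emb 1)) (hS : IsMonster Lang S)
    (H : AddSubgroup S) :
    IsTypeDefinable Lang (H : Set S) ↔ H = ⊥ ∨ H = infinitesimals S ∨ H = ⊤ := by
  constructor
  · intro hH
    have hemb : ∀ r : ℝ, S.emb r ∈ H → r ≠ 0 → H = ⊤ := fun r hr h0 =>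
      hH.eq_top hV hS hr ((emb_mem_infinitesimals_iff hV r).not.2 h0)
    rcases hH.isInvariant.cases hV hS with h | ⟨R, rfl⟩ | h
    · by_cases hbot : H = ⊥
      · exact Or.inl hbot
      · obtain ⟨x, hx, hx0⟩ := (AddSubgroup.bot_or_exists_ne_zero H).resolve_left hbot
        obtain ⟨q, hq⟩ := h hx
        refine Or.inr (Or.inr (hemb (q : ℝ) ?_ ?_))
        · exact (show S.emb (q : ℝ) = x from hq) ▸ hx
        · intro h0
          rw [← hq] at hx0
          refine hx0 ?_
          change S.emb (q : ℝ) = 0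
          rw [h0, emb_zero]
    · by_cases hR : R = ⊥
      · exact Or.inr (Or.inl (by rw [hR, AddSubgroup.map_bot, sup_bot_eq]))
      · obtain ⟨r, hr, hr0⟩ := (AddSubgroup.bot_or_exists_ne_zero R).resolve_left hR
        exact Or.inr (Or.inr (hemb r ((le_sup_right : _ ≤ infinitesimals S ⊔ _) ⟨r, hr, rfl⟩) hr0))
    · exact Or.inr (Or.inr h)
  · rintro (rfl | rfl | rfl)
    · refine ⟨{zeroFormula}, ?_⟩
      ext x
      simp [realize_zeroFormula_iff]
    · refine ⟨{φ | ∃ k, φ = intervalFormula k}, ?_⟩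
      ext x
      simp only [SetLike.mem_coe, mem_infinitesimals_iff hV, Set.mem_ofPred_eq, forall_exists_index,
        forall_eq_apply_imp_iff, realize_intervalFormula_iff hV]
      refine ⟨fun h k => h _, fun h n => ?_⟩
      rcases n with _ | n
      · simpa using hV.unit_pos.le
      · exact h n
    · exact ⟨∅, by ext; simp⟩

end TypeDefinable

/-! ### Subgroups definable with parameters -/

section Definable

/-- A definable set is a union of cells of a finite set of thresholds. -/
theorem exists_finite_thresholds {V : Type*} [AddCommGroup V] [LinearOrder V] [Lang.Structure V]
    [IsOrderedAddMonoid V] {e : V} (hV : IsIntervalGroup V e) {X : Set V}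
    (hX : (Set.univ : Set V).Definable₁ Lang X) :
    ∃ T : Set V, T.Finite ∧ ∀ x y, (∀ t ∈ T, (t < x ↔ t < y) ∧ (x < t ↔ y < t)) →
      (x ∈ X ↔ y ∈ X) := by
  -- The finitely many parameters become extra variables, kept fixed while the last variable moves;
  -- the thresholds over them are the required finite set.
  obtain ⟨A, -, hA⟩ := Set.definable_iff_finitely_definable.1 hX
  obtain ⟨φ, hφ⟩ := Set.definable_iff_exists_formula_sum.1 hA
  let ψ : Lang.BoundedFormula (A : Set V) 1 := BoundedFormula.relabel id φ
  have hψ : ∀ x : V, x ∈ X ↔ ψ.Realize (fun a => (a : V)) (Fin.snoc default x) := by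
    intro x
    have h1 : x ∈ X ↔ (fun _ => x : Fin 1 → V) ∈ {v : Fin 1 → V | v 0 ∈ X} := Iff.rfl
    rw [h1, hφ, BoundedFormula.realize_relabel]
    refine iff_of_eq ?_
    refine congrArg₂ (BoundedFormula.Realize φ) ?_ (Subsingleton.elim _ _)
    funext i
    rcases i with a | i
    · rfl
    · rw [Subsingleton.elim i 0]
      rfl
  obtain ⟨N, hN, h⟩ := exists_agree_realize_iff hV ψ
  refine ⟨_, (finite_thresholdIndex _ N).image fun s => threshold hV
    (Sum.elim (fun a : (A : Set V) => (a : V)) (default : Fin 0 → V)) s.1 s.2.1 s.2.2,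
    fun x y hxy => ?_⟩
  rw [hψ, hψ]
  exact h _ _ _ _ (agree_elim_snoc hV (fun _ _ _ _ => Iff.rfl)
    fun s hs => hxy _ ⟨s, hs, rfl⟩)

variable {V : Type*} [AddCommGroup V] [LinearOrder V] [IsOrderedAddMonoid V]

/-- A subgroup which is a finite union of cells is convex. -/
theorem mem_of_le_of_cells {H : AddSubgroup V} {T : Set V} (hT : T.Finite)
    (hH : ∀ x y, (∀ t ∈ T, (t < x ↔ t < y) ∧ (x < t ↔ y < t)) → (x ∈ H ↔ y ∈ H))
    {h z : V} (hh : h ∈ H) (hz : 0 ≤ z) (hzh : z ≤ h) : z ∈ H := by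
  have := hT.to_subtype
  have h0 : 0 ≤ h := hz.trans hzh
  obtain ⟨m, n, hmn, heq⟩ : ∃ m n : ℕ, m < n ∧ ∀ t ∈ T, (t < m • h ↔ t < n • h) ∧
      (m • h < t ↔ n • h < t) := by
    -- Pigeonhole: two multiples `m h`, `n h` share a cell. As `m h + z` lies between them it shares
    -- it too, so it is in `H`, and so is `z`.
    obtain ⟨m, n, hmn, heq⟩ := Finite.exists_ne_map_eq_of_infinite
      (fun (n : ℕ) (t : T) => ((t : V) < n • h, n • h < (t : V)))
    have key : ∀ t ∈ T, (t < m • h ↔ t < n • h) ∧ (m • h < t ↔ n • h < t) := fun t ht => by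
      have := congrFun heq ⟨t, ht⟩
      simp only [Prod.mk.injEq, eq_iff_iff] at this
      exact this
    rcases lt_or_gt_of_ne hmn with hlt | hlt
    · exact ⟨m, n, hlt, key⟩
    · exact ⟨n, m, hlt, fun t ht => ⟨(key t ht).1.symm, (key t ht).2.symm⟩⟩
  have h1 : m • h ≤ m • h + z := le_add_of_nonneg_right hz
  have h2 : m • h + z ≤ n • h := (add_le_add_right hzh _).trans (by
    rw [← succ_nsmul]
    exact nsmul_le_nsmul_left h0 hmn)
  have h3 := (hH (m • h) (m • h + z) fun t ht => by
    obtain ⟨e1, e2⟩ := heq t ht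
    exact ⟨⟨fun h => h.trans_le h1, fun h => e1.2 (h.trans_le h2)⟩,
      ⟨fun h => h2.trans_lt (e2.1 h), fun h => h1.trans_lt h⟩⟩).1 (nsmul_mem hh m)
  simpa using sub_mem h3 (nsmul_mem hh m)

/-- In a divisible ordered group, only the trivial subgroups are finite unions of cells. -/
theorem eq_bot_or_eq_top_of_cells (hdiv : ∀ x : V, ∃ y, 2 • y = x)
    {H : AddSubgroup V} {T : Set V} (hT : T.Finite)
    (hH : ∀ x y, (∀ t ∈ T, (t < x ↔ t < y) ∧ (x < t ↔ y < t)) → (x ∈ H ↔ y ∈ H)) :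
    H = ⊥ ∨ H = ⊤ := by
  by_contra! hne
  have habs : ∀ x : V, |x| ∈ H ↔ x ∈ H := fun x => by
    rcases abs_choice x with h | h <;> rw [h]
    exact neg_mem_iff
  have hlt : ∀ h ∈ H, ∀ x : V, 0 ≤ x → x ∉ H → h < x := fun h hh x hx0 hx => by
    by_contra! hle
    exact hx (mem_of_le_of_cells hT hH hh hx0 hle)
  obtain ⟨g, hg, hg0⟩ := (AddSubgroup.bot_or_exists_ne_zero H).resolve_left hne.1
  obtain ⟨z, hz⟩ : ∃ z, z ∉ H := by
    by_contra! h
    exact hne.2 (eq_top_iff.2 fun x _ => h x)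
  -- By convexity `H` lies below every nonnegative element outside it. Choosing `h` in `H` above all
  -- thresholds in `H`, and `x ≥ 0` outside `H` below all nonnegative thresholds outside `H`, leaves
  -- no threshold separating `h` from `x`: the same cell would meet both `H` and its complement.
  have hbelow : ∃ h ∈ H, ∀ t ∈ T, t ∈ H → t < h := by
    rcases (T ∩ H).eq_empty_or_nonempty with hE | hE
    · exact ⟨g, hg, fun t ht htH => absurd (show t ∈ T ∩ H from ⟨ht, htH⟩) (by simp [hE])⟩
    · obtain ⟨t, ht, hmax⟩ := Set.exists_max_image _ id (hT.inter_of_left H) hE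
      exact ⟨t + |g|, add_mem ht.2 ((habs g).2 hg), fun s hs hsH =>
        (hmax s ⟨hs, hsH⟩).trans_lt (lt_add_of_pos_right _ (abs_pos.2 hg0))⟩
  have habove : ∃ x ∉ H, 0 ≤ x ∧ ∀ t ∈ T, 0 ≤ t → t ∉ H → x < t := by
    rcases (T ∩ {t | 0 ≤ t ∧ t ∉ H}).eq_empty_or_nonempty with hE | hE
    · exact ⟨|z|, (habs z).not.2 hz, abs_nonneg z, fun t ht h0 htH =>
        absurd (show t ∈ T ∩ {t | 0 ≤ t ∧ t ∉ H} from ⟨ht, h0, htH⟩) (by simp [hE])⟩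
    · obtain ⟨t, ⟨-, h0, htH⟩, hmin⟩ := Set.exists_min_image _ id (hT.inter_of_left _) hE
      -- Half of the least such threshold is still outside `H` and is strictly smaller.
      obtain ⟨y, rfl⟩ := hdiv t
      have hyH : y ∉ H := fun h => htH (nsmul_mem h 2)
      rw [nsmul_nonneg_iff two_ne_zero] at h0
      have hy : 0 < y := lt_of_le_of_ne h0 fun h => hyH (h ▸ zero_mem H)
      refine ⟨y, hyH, h0, fun s hs hs0 hsH => ?_⟩
      refine lt_of_lt_of_le ?_ (hmin s ⟨hs, hs0, hsH⟩)
      simpa [two_nsmul] using hy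
  obtain ⟨h, hh, hhT⟩ := hbelow
  obtain ⟨x, hx, hx0, hxT⟩ := habove
  have hhx := hlt h hh x hx0 hx
  refine hx ((hH h x fun t ht => ?_).1 hh)
  by_cases htH : t ∈ H
  · have := hhT t ht htH
    exact ⟨iff_of_true this (this.trans hhx), iff_of_false this.not_gt (this.trans hhx).not_gt⟩
  · rcases le_or_gt 0 t with h0 | h0
    · have := hxT t ht h0 htH
      exact ⟨iff_of_false (hhx.trans this).not_gt this.not_gt, iff_of_true (hhx.trans this) this⟩
    · have h1 : t < h := by
        have := hlt (-h) (neg_mem hh) (-t) (neg_nonneg.2 h0.le) (by rwa [neg_mem_iff])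
        exact neg_lt_neg_iff.1 this
      exact ⟨iff_of_true h1 (h1.trans hhx), iff_of_false h1.not_gt (h1.trans hhx).not_gt⟩

theorem definable₁_iff {S : ElementaryExtension.{u}} [LinearOrder S] [IsOrderedAddMonoid S]
    (hV : IsIntervalGroup S (S.emb 1)) (H : AddSubgroup S) :
    (Set.univ : Set S).Definable₁ Lang (H : Set S) ↔ H = ⊥ ∨ H = ⊤ := by
  constructor
  · intro hH
    obtain ⟨T, hT, h⟩ := exists_finite_thresholds hV hH
    exact eq_bot_or_eq_top_of_cells (fun x => exists_nsmul_eq S 1 x) hT h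
  · rintro (rfl | rfl)
    · refine Set.Definable.mono (Set.empty_definable_iff.2 ⟨zeroFormula, ?_⟩) (Set.empty_subset _)
      ext v
      exact (realize_zeroFormula_iff S v).symm
    · refine Set.Definable.mono (Set.empty_definable_iff.2 ⟨⊤, ?_⟩) (Set.empty_subset _)
      ext v
      simp

end Definable
end UnitIntervalGroup

theorem mainTheorem6 (S : UnitIntervalGroup.ElementaryExtension.{u})
    (hS : UnitIntervalGroup.IsMonster UnitIntervalGroup.Lang S) :
    (∀ H : AddSubgroup S, UnitIntervalGroup.IsInvariant UnitIntervalGroup.Lang (H : Set S) ↔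
      H = ⊥ ∨ H ≤ UnitIntervalGroup.rationals S ∨
        (∃ R : AddSubgroup ℝ,
          H = UnitIntervalGroup.infinitesimals S ⊔ R.map (UnitIntervalGroup.incl S)) ∨
        H = ⊤) ∧
    (∀ H : AddSubgroup S, UnitIntervalGroup.IsTypeDefinable UnitIntervalGroup.Lang (H : Set S) ↔
      H = ⊥ ∨ H = UnitIntervalGroup.infinitesimals S ∨ H = ⊤) ∧
    (∀ H : AddSubgroup S, (Set.univ : Set S).Definable₁ UnitIntervalGroup.Lang (H : Set S) ↔
      H = ⊥ ∨ H = ⊤) := by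
  obtain ⟨_, _, hV⟩ := UnitIntervalGroup.exists_isIntervalGroup S
  exact ⟨UnitIntervalGroup.isInvariant_iff hV hS, UnitIntervalGroup.isTypeDefinable_iff hV hS,
    UnitIntervalGroup.definable₁_iff hV⟩
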